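/- Let $k$ be a field, $Q_{inner},Q_{outer}\in k$ and $n\ge 0$. A ramified diagram $a=(a_1,a_2)$ is a pair of set partitions of $\{1,\dots,n\}\cup\{1',\dots,n'\}$ such that the inner partition $a_1$ refines the outer partition $a_2$. Stacking two set partitions $p$, $q$ of $\{1,\dots,n\}\cup\{1',\dots,n'\}$ ($p$ above $q$, the lower row of $p$ being identified with the upper row of $q$) and taking the generated partition gives, by restriction to the two outside rows, a partition $d(pq)$, and a number $c(p,q)$ of parts lying entirely in the middle row. The ramified partition algebra $P=P_n^{(2)}(Q_{inner},Q_{outer})$ is the associative unital $k$-algebra with basis the ramified diagrams and product $$ab=Q_{inner}^{c(a_1,b_1)}\,Q_{outer}^{c(a_2,b_2)}\,\bigl(d(a_1b_1),d(a_2b_2)\bigr).$$ A part is propagating if it meets both $\{1,\dots,n\}$ and $\{1',\dots,n'\}$. The propagating index of $a$ is the weakly decreasing list (zeros allowed) of the numbers of propagating parts of $a_1$ contained in $q$, where $q$ runs over the propagating parts of $a_2$. Indices are partially ordered by $\mu\le\lambda$ if $\mu$ is obtained from $\lambda$ by finitely many steps of the following kinds: lowering a positive component by $1$, replacing two components by their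 sum, deleting a component $0$. The propagating envelope of $\lambda$ is $\sum_i f(\lambda_i)$, where $f(0)=1$ and $f(j)=j$ for $j>0$. For an index $\lambda$ of envelope at most $n$, cut $1,2,\dots$ into consecutive blocks $B_1,B_2,\dots$ of sizes $f(\lambda_1),f(\lambda_2),\dots$, and let $I_\lambda$ be the ramified diagram whose outer parts are the sets $B_i\cup B_i'$ and, for $j$ in no block, the singletons $\{j\},\{j'\}$, and whose inner parts are the pairs $\{j,j'\}$ for $j\in B_i$ with $\lambda_i>0$, and singletons otherwise. Let $S[\lambda]$ be the group of permutations of $\{1,\dots,n\}$ that permute the blocks $B_i$ having equal $\lambda_i$ among each other, permute the elements inside the blocks, and fix all $j$ in no block; it is isomorphic to $\prod_j S_j\wr S_{m_j}$, where $m_j$ is the multiplicity of $j$ in $\lambda$. It embeds in $P$ by $\sigma\mapsto$ the diagram with inner and outer partition $\{\{\sigma(i),i'\}\}_i$, and commutes with $I_\lambda$. Let $J_{<\lambda}$ be the two-sided ideal of $P$ generated by the diagrams of index $\mu<\lambda$, and let $P[\lambda]'$ be the image of $PI_\lambda$ in $P/J_{<\lambda}$, a $(P,kS[\lambda])$-bimodule.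 For a simple left $kS[\lambda]$-module $L_\Theta$, the standard module is the left $P$-module $$\mathcal S(\Theta)(n)=P[\lambda]'\otimes_{kS[\lambda]}L_\Theta ,$$ and the propagating envelope of $\Theta$ is that of $\lambda$. **Proposition.** If the propagating envelope of $\Theta$ equals $n$ and $Q_{inner}$ is invertible in $k$, then the $P$-module $\mathcal S(\Theta)(n)$ is simple. -/

import Mathlib

open scoped TensorProduct

noncomputable section

namespace RamifiedPartition

/-! ### Stacking set partitions

Set partitions of a set are equivalence relations on it, and `a ≤ b` says that `a` refines `b`. -/

section Stack

variable {X Y Z W : Type*}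

/-- The partition of `X ∪ Y ∪ Z` generated by a partition `a` of `X ∪ Y` and a partition `b` of
`Y ∪ Z`. The middle row `Y` is the right summand of `(X ⊕ Z) ⊕ Y`. -/
def stack (a : Setoid (X ⊕ Y)) (b : Setoid (Y ⊕ Z)) : Setoid ((X ⊕ Z) ⊕ Y) :=
  a.map (Sum.elim (fun x => Sum.inl (Sum.inl x)) Sum.inr) ⊔
    b.map (Sum.elim Sum.inr (fun z => Sum.inl (Sum.inr z)))

/-- The composite partition of `X ∪ Z`: the restriction of `stack a b` to the exterior rows. -/
def comp (a : Setoid (X ⊕ Y)) (b : Setoid (Y ⊕ Z)) : Setoid (X ⊕ Z) :=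
  (stack a b).comap Sum.inl

/-- The number of parts of `stack a b` that are contained in the middle row. -/
def loops (a : Setoid (X ⊕ Y)) (b : Setoid (Y ⊕ Z)) : ℕ :=
  Nat.card {q : Quotient (stack a b) // ∀ v, Quotient.mk _ v = q → v ∈ Set.range Sum.inr}

theorem comp_mono {a a' : Setoid (X ⊕ Y)} {b b' : Setoid (Y ⊕ Z)} (ha : a ≤ a') (hb : b ≤ b') :
    comp a b ≤ comp a' b' := by
  have hst : stack a b ≤ stack a' b' := by
    refine sup_le_sup ?_ ?_
    · exact Setoid.eqvGen_mono (by rintro _ _ ⟨x, y, hxy, rfl, rfl⟩; exact ⟨x, y, ha hxy, rfl, rfl⟩)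
    · exact Setoid.eqvGen_mono (by rintro _ _ ⟨x, y, hxy, rfl, rfl⟩; exact ⟨x, y, hb hxy, rfl, rfl⟩)
  intro x y h
  exact hst h

/-! Associativity of the product below is proved by counting two-colourings: `wt a s t` is `1` if
the colouring `(s, t)` is constant on the parts of `a`, and `0` otherwise. -/

open Classical in
/-- The indicator that the two-colouring `(s, t)` is constant on the parts of `a`. -/
def wt (a : Setoid (X ⊕ Y)) (s : X → Bool) (t : Y → Bool) : ℕ :=
  if a ≤ Setoid.ker (Sum.elim s t) then 1 else 0

theorem map_le_ker {A B C : Type*} (r : Setoid A) (f : A → B) (φ : B → C) :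
    r.map f ≤ Setoid.ker φ ↔ r ≤ Setoid.ker (φ ∘ f) := by
  constructor
  · intro h x y hxy
    exact h (Setoid.le_comap_map hxy)
  · intro h
    refine Setoid.eqvGen_le ?_
    rintro _ _ ⟨x, y, hxy, rfl, rfl⟩
    exact h hxy

theorem stack_le_ker (a : Setoid (X ⊕ Y)) (b : Setoid (Y ⊕ Z)) (s : X → Bool) (t : Y → Bool)
    (u : Z → Bool) :
    stack a b ≤ Setoid.ker (Sum.elim (Sum.elim s u) t) ↔
      a ≤ Setoid.ker (Sum.elim s t) ∧ b ≤ Setoid.ker (Sum.elim t u) := by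
  rw [stack, sup_le_iff, map_le_ker, map_le_ker]
  have h1 : (Sum.elim (Sum.elim s u) t) ∘ (Sum.elim (fun x => Sum.inl (Sum.inl x)) Sum.inr) =
      Sum.elim s t := by
    funext v; rcases v with v | v <;> rfl
  have h2 : (Sum.elim (Sum.elim s u) t) ∘ (Sum.elim Sum.inr (fun z => Sum.inl (Sum.inr z))) =
      Sum.elim t u := by
    funext v; rcases v with v | v <;> rfl
  rw [h1, h2]

open Classical in
theorem card_extensions [Finite W] [Finite Y] (r : Setoid (W ⊕ Y)) (ψ : W → Bool) :
    Nat.card {t : Y → Bool // r ≤ Setoid.ker (Sum.elim ψ t)} =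
      if r.comap Sum.inl ≤ Setoid.ker ψ then
        2 ^ Nat.card {q : Quotient r // ∀ v, Quotient.mk _ v = q → v ∈ Set.range Sum.inr}
      else 0 := by
  split_ifs with hψ
  · have hex : ∀ q : Quotient r, ¬ (∀ v, Quotient.mk _ v = q → v ∈ Set.range Sum.inr) →
        ∃ w, Quotient.mk r (Sum.inl w) = q := by
      intro q hq
      push Not at hq
      obtain ⟨v, hv, hv'⟩ := hq
      rcases v with w | y
      · exact ⟨w, hv⟩
      · exact absurd ⟨y, rfl⟩ hv'
    let G : ({q : Quotient r // ∀ v, Quotient.mk _ v = q → v ∈ Set.range Sum.inr} → Bool) →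
        Quotient r → Bool := fun g q =>
      if h : ∀ v, Quotient.mk _ v = q → v ∈ Set.range Sum.inr then g ⟨q, h⟩
      else ψ (hex q h).choose
    have hG : ∀ g, Sum.elim ψ (fun y => G g (Quotient.mk _ (Sum.inr y))) =
        fun v => G g (Quotient.mk _ v) := by
      intro g
      funext v
      rcases v with w | y
      · have hn : ¬ (∀ v, Quotient.mk r v = Quotient.mk r (Sum.inl w) →
            v ∈ Set.range (Sum.inr : Y → W ⊕ Y)) := by
          intro h
          obtain ⟨y, hy⟩ := h _ rfl
          cases hy
        simp only [Sum.elim_inl, G, dif_neg hn]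
        have := (hex _ hn).choose_spec
        have hr : r (Sum.inl (hex _ hn).choose) (Sum.inl w) := Quotient.exact this
        exact hψ (r.symm' hr)
      · rfl
    let e : {t : Y → Bool // r ≤ Setoid.ker (Sum.elim ψ t)} ≃
        ({q : Quotient r // ∀ v, Quotient.mk _ v = q → v ∈ Set.range Sum.inr} → Bool) :=
      { toFun := fun t q => Quotient.lift (Sum.elim ψ t.1) (fun _ _ h => t.2 h) q.1
        invFun := fun g => ⟨fun y => G g (Quotient.mk _ (Sum.inr y)), by
          rw [hG]
          intro x y hxy
          exact congrArg (G g) (Quotient.sound hxy)⟩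
        left_inv := by
          intro t
          apply Subtype.ext
          funext y
          by_cases h : ∀ v, Quotient.mk _ v = Quotient.mk r (Sum.inr y) → v ∈ Set.range Sum.inr
          · simp only [G, dif_pos h]
            rfl
          · simp only [G, dif_neg h]
            have := (hex _ h).choose_spec
            exact t.2 (Quotient.exact this)
        right_inv := by
          intro g
          funext q
          obtain ⟨q, hq⟩ := q
          induction q using Quotient.inductionOn with
          | h v =>
            have := congrFun (hG g) v
            simp only [Quotient.lift_mk]
            rw [this]
            simp only [G, dif_pos hq] }
    rw [Nat.card_congr e, Nat.card_fun]
    simp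
  · have : IsEmpty {t : Y → Bool // r ≤ Setoid.ker (Sum.elim ψ t)} :=
      ⟨fun t => hψ fun {x y} h => t.2 h⟩
    exact Nat.card_of_isEmpty

theorem sum_wt [Finite X] [Fintype Y] [DecidableEq Y] [Finite Z] (a : Setoid (X ⊕ Y))
    (b : Setoid (Y ⊕ Z)) (s : X → Bool) (u : Z → Bool) :
    ∑ t : Y → Bool, wt a s t * wt b t u = 2 ^ loops a b * wt (comp a b) s u := by
  classical
  have h := card_extensions (stack a b) (Sum.elim s u)
  have h1 : ∑ t : Y → Bool, wt a s t * wt b t u =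
      Nat.card {t : Y → Bool // stack a b ≤ Setoid.ker (Sum.elim (Sum.elim s u) t)} := by
    rw [Nat.card_eq_fintype_card, Fintype.card_subtype, Finset.card_filter]
    refine Finset.sum_congr rfl fun t _ => ?_
    simp only [wt, stack_le_ker]
    by_cases h1 : a ≤ Setoid.ker (Sum.elim s t) <;> by_cases h2 : b ≤ Setoid.ker (Sum.elim t u) <;>
      simp [h1, h2]
  rw [h1, h, wt]
  by_cases hc : comp a b ≤ Setoid.ker (Sum.elim s u)
  · rw [if_pos hc, mul_one]
    exact if_pos hc
  · rw [if_neg hc, mul_zero]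
    exact if_neg hc

theorem wt_false (a : Setoid (X ⊕ Y)) : wt a (fun _ => false) (fun _ => false) = 1 := by
  rw [wt, if_pos]
  intro x y _
  rcases x with x | x <;> rcases y with y | y <;> rfl

theorem eq_of_wt {a b : Setoid (X ⊕ Y)} (h : ∀ s t, wt a s t = wt b s t) : a = b := by
  classical
  have key : ∀ {a b : Setoid (X ⊕ Y)}, (∀ s t, wt a s t = wt b s t) → a ≤ b := by
    intro a b h x y hxy
    let φ : X ⊕ Y → Bool := fun v => decide (b x v)
    have hφ : Sum.elim (fun v => φ (Sum.inl v)) (fun v => φ (Sum.inr v)) = φ := by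
      funext v; rcases v with v | v <;> rfl
    have hb : b ≤ Setoid.ker φ := by
      intro v w hvw
      have : b x v ↔ b x w := ⟨fun h => b.trans' h hvw, fun h => b.trans' h (b.symm' hvw)⟩
      exact decide_eq_decide.2 this
    have h1 := h (fun v => φ (Sum.inl v)) (fun v => φ (Sum.inr v))
    rw [wt, wt, hφ, if_pos hb] at h1
    have ha : a ≤ Setoid.ker φ := by
      by_contra hc
      rw [if_neg hc] at h1
      exact absurd h1 (by norm_num)
    have h2 : decide (b x x) = decide (b x y) := ha hxy
    rw [decide_eq_decide] at h2
    exact h2.1 (b.refl' x)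
  exact le_antisymm (key h) (key fun s t => (h s t).symm)

theorem eq_of_pow_wt {a b : Setoid (X ⊕ Y)} {p q : ℕ}
    (h : ∀ s t, 2 ^ p * wt a s t = 2 ^ q * wt b s t) : p = q ∧ a = b := by
  have hp : p = q := by
    have := h (fun _ => false) (fun _ => false)
    rw [wt_false, wt_false, mul_one, mul_one] at this
    exact Nat.pow_right_injective le_rfl this
  subst hp
  exact ⟨rfl, eq_of_wt fun s t => Nat.eq_of_mul_eq_mul_left (pow_pos two_pos p) (h s t)⟩

theorem comp_assoc {V : Type*} [Finite X] [Finite Y] [Finite Z] [Finite V]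
    (a : Setoid (X ⊕ Y)) (b : Setoid (Y ⊕ Z)) (c : Setoid (Z ⊕ V)) :
    loops a b + loops (comp a b) c = loops b c + loops a (comp b c) ∧
      comp (comp a b) c = comp a (comp b c) := by
  classical
  have := Fintype.ofFinite Y
  have := Fintype.ofFinite Z
  refine eq_of_pow_wt fun s t => ?_
  rw [pow_add, pow_add, mul_assoc, mul_assoc, ← sum_wt, ← sum_wt, Finset.mul_sum, Finset.mul_sum]
  simp_rw [← mul_assoc, ← sum_wt, mul_comm (2 ^ loops b c) (wt a _ _), mul_assoc, ← sum_wt,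
    Finset.mul_sum, Finset.sum_mul, mul_assoc]
  exact Finset.sum_comm

/-- The partition of two rows whose parts are the pairs `{σ i, i'}`. -/
def permPart (σ : Equiv.Perm X) : Setoid (X ⊕ X) :=
  Setoid.ker (Sum.elim id σ)

open Classical in
theorem wt_permPart (σ : Equiv.Perm X) (s t : X → Bool) :
    wt (permPart σ) s t = if t = s ∘ σ then 1 else 0 := by
  have : permPart σ ≤ Setoid.ker (Sum.elim s t) ↔ t = s ∘ σ := by
    constructor
    · intro h
      funext x
      exact (h (show permPart σ (Sum.inl (σ x)) (Sum.inr x) from rfl)).symm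
    · rintro rfl x y hxy
      rw [permPart, Setoid.ker_def] at hxy
      rw [Setoid.ker_def]
      have : ∀ v : X ⊕ X, Sum.elim s (s ∘ σ) v = s (Sum.elim id σ v) := by
        intro v; rcases v with v | v <;> rfl
      rw [this, this, hxy]
  simp only [wt, this]

theorem permPart_comp [Finite X] [Finite Z] (σ : Equiv.Perm X) (a : Setoid (X ⊕ Z)) :
    loops (permPart σ) a = 0 ∧ ∀ s t, wt (comp (permPart σ) a) s t = wt a (s ∘ σ) t := by
  classical
  have := Fintype.ofFinite X
  have h : ∀ s t, 2 ^ loops (permPart σ) a * wt (comp (permPart σ) a) s t = wt a (s ∘ σ) t := by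
    intro s t
    rw [← sum_wt]
    simp [wt_permPart]
  have h0 : loops (permPart σ) a = 0 := by
    have := h (fun _ => false) (fun _ => false)
    rw [wt_false, show ((fun _ => false : X → Bool) ∘ σ) = fun _ => false from rfl, wt_false,
      mul_one] at this
    exact Nat.pow_right_injective le_rfl (this.trans (pow_zero 2).symm)
  refine ⟨h0, fun s t => ?_⟩
  have := h s t
  rwa [h0, pow_zero, one_mul] at this

theorem comp_permPart [Finite X] [Finite Z] (σ : Equiv.Perm X) (a : Setoid (Z ⊕ X)) :
    loops a (permPart σ) = 0 ∧
      ∀ s t, wt (comp a (permPart σ)) s t = wt a s (t ∘ σ.symm) := by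
  classical
  have := Fintype.ofFinite X
  have h : ∀ s t, 2 ^ loops a (permPart σ) * wt (comp a (permPart σ)) s t =
      wt a s (t ∘ σ.symm) := by
    intro s t
    rw [← sum_wt]
    have : ∀ r : X → Bool, t = r ∘ σ ↔ r = t ∘ σ.symm := by
      intro r
      rw [Equiv.eq_comp_symm]
      exact eq_comm
    simp [wt_permPart, this]
  have h0 : loops a (permPart σ) = 0 := by
    have := h (fun _ => false) (fun _ => false)
    rw [wt_false, show ((fun _ => false : X → Bool) ∘ σ.symm) = fun _ => false from rfl, wt_false,
      mul_one] at this
    exact Nat.pow_right_injective le_rfl (this.trans (pow_zero 2).symm)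
  refine ⟨h0, fun s t => ?_⟩
  have := h s t
  rwa [h0, pow_zero, one_mul] at this

end Stack

/-! ### Ramified diagrams -/

/-- An element of `p_n^{(2)}`: a pair of partitions of `{1, …, n} ∪ {1', …, n'}`, the inner one
refining the outer one. `Sum.inl i` is the unprimed and `Sum.inr i` the primed copy of `i`. -/
@[ext]
structure Diagram (n : ℕ) where
  /-- the inner partition -/
  inner : Setoid (Fin n ⊕ Fin n)
  /-- the outer partition -/
  outer : Setoid (Fin n ⊕ Fin n)
  /-- the inner partition refines the outer one -/
  inner_le_outer : inner ≤ outer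

namespace Diagram

variable {n : ℕ}

/-- The diagram obtained by stacking, ignoring the scalar. -/
def mul (a b : Diagram n) : Diagram n where
  inner := comp a.inner b.inner
  outer := comp a.outer b.outer
  inner_le_outer := comp_mono a.inner_le_outer b.inner_le_outer

/-- The diagonal diagram `(σ, σ)` of a permutation. -/
def perm (σ : Equiv.Perm (Fin n)) : Diagram n where
  inner := permPart σ
  outer := permPart σ
  inner_le_outer := le_rfl

theorem mul_assoc' (a b c : Diagram n) : (a.mul b).mul c = a.mul (b.mul c) :=
  Diagram.ext (comp_assoc _ _ _).2 (comp_assoc _ _ _).2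

theorem perm_one_mul (a : Diagram n) : (perm 1).mul a = a :=
  Diagram.ext (eq_of_wt (permPart_comp 1 a.inner).2) (eq_of_wt (permPart_comp 1 a.outer).2)

theorem mul_perm_one (a : Diagram n) : a.mul (perm 1) = a :=
  Diagram.ext (eq_of_wt (comp_permPart 1 a.inner).2) (eq_of_wt (comp_permPart 1 a.outer).2)

theorem perm_mul_perm (σ τ : Equiv.Perm (Fin n)) :
    (perm σ).mul (perm τ) = perm (σ * τ) := by
  have : comp (permPart σ) (permPart τ) = permPart (σ * τ) := by
    refine eq_of_wt fun s t => ?_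
    rw [(permPart_comp σ _).2, wt_permPart, wt_permPart]
    rfl
  exact Diagram.ext this this

end Diagram

/-! ### The ramified partition algebra -/

variable {k : Type*} [Field k]

/-- The ramified partition algebra `P_n^{(2)}(Q₁, Q₂)`: the `k`-space with basis `p_n^{(2)}`, with
`a b = Q₁ ^ c(a₁, b₁) Q₂ ^ c(a₂, b₂) d(ab)` on the basis; index `1` is the inner level. -/
@[nolint unusedArguments]
def Alg (_Q₁ _Q₂ : k) (n : ℕ) : Type _ := Diagram n →₀ k

namespace Alg

variable {Q₁ Q₂ : k} {n : ℕ}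

instance : AddCommGroup (Alg Q₁ Q₂ n) := inferInstanceAs (AddCommGroup (Diagram n →₀ k))

instance : Module k (Alg Q₁ Q₂ n) := inferInstanceAs (Module k (Diagram n →₀ k))

variable (Q₁ Q₂) in
/-- The basis vector of a diagram. -/
def basis (a : Diagram n) : Alg Q₁ Q₂ n := Finsupp.single a 1

variable (Q₁ Q₂) in
/-- The product of two basis vectors. -/
def basisMul (a b : Diagram n) : Alg Q₁ Q₂ n :=
  (Q₁ ^ loops a.inner b.inner * Q₂ ^ loops a.outer b.outer) • basis Q₁ Q₂ (a.mul b)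

variable (Q₁ Q₂ n) in
/-- The bilinear extension of the product of basis vectors. -/
def mulHom : Alg Q₁ Q₂ n →ₗ[k] Alg Q₁ Q₂ n →ₗ[k] Alg Q₁ Q₂ n :=
  Finsupp.linearCombination k fun a => Finsupp.linearCombination k fun b => basisMul Q₁ Q₂ a b

theorem mulHom_basis (a b : Diagram n) :
    mulHom Q₁ Q₂ n (basis Q₁ Q₂ a) (basis Q₁ Q₂ b) = basisMul Q₁ Q₂ a b := by
  simp only [mulHom, basis]
  erw [Finsupp.linearCombination_single, one_smul, Finsupp.linearCombination_single, one_smul]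

theorem hom_ext {M : Type*} [AddCommMonoid M] [Module k M] {f g : Alg Q₁ Q₂ n →ₗ[k] M}
    (h : ∀ a, f (basis Q₁ Q₂ a) = g (basis Q₁ Q₂ a)) : f = g :=
  Finsupp.lhom_ext' fun a => LinearMap.ext_ring (h a)

theorem mulHom_basisMul_left (a b c : Diagram n) :
    mulHom Q₁ Q₂ n (basisMul Q₁ Q₂ a b) (basis Q₁ Q₂ c) =
      mulHom Q₁ Q₂ n (basis Q₁ Q₂ a) (basisMul Q₁ Q₂ b c) := by
  rw [basisMul, basisMul, map_smul, map_smul, LinearMap.smul_apply, mulHom_basis, mulHom_basis,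
    basisMul, basisMul, smul_smul, smul_smul, Diagram.mul_assoc']
  congr 1
  have h1 := (comp_assoc a.inner b.inner c.inner).1
  have h2 := (comp_assoc a.outer b.outer c.outer).1
  rw [mul_mul_mul_comm, ← pow_add, ← pow_add, mul_mul_mul_comm, ← pow_add, ← pow_add]
  simp only [Diagram.mul]
  rw [h1, h2]

theorem mulHom_assoc (x y z : Alg Q₁ Q₂ n) :
    mulHom Q₁ Q₂ n (mulHom Q₁ Q₂ n x y) z = mulHom Q₁ Q₂ n x (mulHom Q₁ Q₂ n y z) := by
  let L := (LinearMap.llcomp k (Alg Q₁ Q₂ n) (Alg Q₁ Q₂ n)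
    (Alg Q₁ Q₂ n →ₗ[k] Alg Q₁ Q₂ n) (mulHom Q₁ Q₂ n)).comp (mulHom Q₁ Q₂ n)
  let R := (LinearMap.llcomp k (Alg Q₁ Q₂ n) (Alg Q₁ Q₂ n →ₗ[k] Alg Q₁ Q₂ n)
    (Alg Q₁ Q₂ n →ₗ[k] Alg Q₁ Q₂ n)).flip (mulHom Q₁ Q₂ n)
      |>.comp ((LinearMap.llcomp k (Alg Q₁ Q₂ n) (Alg Q₁ Q₂ n) (Alg Q₁ Q₂ n)).comp
        (mulHom Q₁ Q₂ n))
  have h : L = R := by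
    refine hom_ext fun a => hom_ext fun b => hom_ext fun c => ?_
    change mulHom Q₁ Q₂ n (mulHom Q₁ Q₂ n (basis Q₁ Q₂ a) (basis Q₁ Q₂ b)) (basis Q₁ Q₂ c) =
      mulHom Q₁ Q₂ n (basis Q₁ Q₂ a) (mulHom Q₁ Q₂ n (basis Q₁ Q₂ b) (basis Q₁ Q₂ c))
    rw [mulHom_basis, mulHom_basis, mulHom_basisMul_left]
  exact LinearMap.congr_fun (LinearMap.congr_fun (LinearMap.congr_fun h x) y) z

theorem basisMul_perm_left (σ : Equiv.Perm (Fin n)) (a : Diagram n) :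
    basisMul Q₁ Q₂ (Diagram.perm σ) a = basis Q₁ Q₂ ((Diagram.perm σ).mul a) := by
  rw [basisMul]
  simp only [Diagram.perm]
  rw [(permPart_comp σ a.inner).1, (permPart_comp σ a.outer).1, pow_zero, pow_zero, one_mul,
    one_smul]

theorem basisMul_perm_right (a : Diagram n) (σ : Equiv.Perm (Fin n)) :
    basisMul Q₁ Q₂ a (Diagram.perm σ) = basis Q₁ Q₂ (a.mul (Diagram.perm σ)) := by
  rw [basisMul]
  simp only [Diagram.perm]
  rw [(comp_permPart σ a.inner).1, (comp_permPart σ a.outer).1, pow_zero, pow_zero, one_mul,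
    one_smul]

theorem one_mulHom (x : Alg Q₁ Q₂ n) : mulHom Q₁ Q₂ n (basis Q₁ Q₂ (Diagram.perm 1)) x = x := by
  have h : mulHom Q₁ Q₂ n (basis Q₁ Q₂ (Diagram.perm 1)) = LinearMap.id :=
    hom_ext fun a => by
      rw [mulHom_basis, basisMul_perm_left, Diagram.perm_one_mul, LinearMap.id_apply]
  rw [h, LinearMap.id_apply]

theorem mulHom_one (x : Alg Q₁ Q₂ n) : mulHom Q₁ Q₂ n x (basis Q₁ Q₂ (Diagram.perm 1)) = x := by
  have h : (mulHom Q₁ Q₂ n).flip (basis Q₁ Q₂ (Diagram.perm 1)) = LinearMap.id :=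
    hom_ext fun a => by
      rw [LinearMap.flip_apply, mulHom_basis, basisMul_perm_right, Diagram.mul_perm_one,
        LinearMap.id_apply]
  exact LinearMap.congr_fun h x

instance : Ring (Alg Q₁ Q₂ n) :=
  { (inferInstance : AddCommGroup (Alg Q₁ Q₂ n)) with
    mul := fun x y => mulHom Q₁ Q₂ n x y
    one := basis Q₁ Q₂ (Diagram.perm 1)
    mul_assoc := mulHom_assoc
    one_mul := one_mulHom
    mul_one := mulHom_one
    left_distrib := fun x y z => map_add (mulHom Q₁ Q₂ n x) y z
    right_distrib := fun x y z => LinearMap.map_add₂ (mulHom Q₁ Q₂ n) x y z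
    zero_mul := fun x => LinearMap.map_zero₂ (mulHom Q₁ Q₂ n) x
    mul_zero := fun x => map_zero (mulHom Q₁ Q₂ n x) }

instance : Algebra k (Alg Q₁ Q₂ n) :=
  Algebra.ofModule (fun r x y => LinearMap.map_smul₂ (mulHom Q₁ Q₂ n) r x y)
    (fun r x y => map_smul (mulHom Q₁ Q₂ n x) r y)

theorem basis_mul_basis (a b : Diagram n) :
    basis Q₁ Q₂ a * basis Q₁ Q₂ b =
      (Q₁ ^ loops a.inner b.inner * Q₂ ^ loops a.outer b.outer) • basis Q₁ Q₂ (a.mul b) :=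
  mulHom_basis a b

variable (Q₁ Q₂ n) in
/-- The inclusion of the symmetric group, `σ ↦ (σ, σ)`. -/
def permHom : Equiv.Perm (Fin n) →* Alg Q₁ Q₂ n where
  toFun σ := basis Q₁ Q₂ (Diagram.perm σ)
  map_one' := rfl
  map_mul' σ τ := by
    rw [← Diagram.perm_mul_perm, ← basisMul_perm_left]
    exact (mulHom_basis _ _).symm

end Alg

/-! ### Propagating indices -/

variable {n : ℕ}

/-- The propagating parts of a partition of two rows: those meeting both rows. -/
abbrev PropPart (a : Setoid (Fin n ⊕ Fin n)) : Type :=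
  {q : Quotient a // (∃ i, Quotient.mk a (Sum.inl i) = q) ∧ ∃ j, Quotient.mk a (Sum.inr j) = q}

/-- The number of propagating parts of the inner partition that lie in the part `q` of the outer
partition. -/
def legs (a : Diagram n) (q : Quotient a.outer) : ℕ :=
  Nat.card {p : PropPart a.inner // Setoid.map_of_le a.inner_le_outer p.1 = q}

open Classical in
/-- The propagating index: the numbers `legs a q` over the propagating parts `q` of the outer
partition. A propagating index is a finite multiset of natural numbers (possibly zero), which
stands for its weakly decreasing list. -/
def propIndex (a : Diagram n) : Multiset ℕ :=
  (@Finset.univ (PropPart a.outer) (Fintype.ofFinite _)).val.map fun q => legs a q.1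

/-- The number of nodes that a component of a propagating index needs: `f 0 = 1` and `f j = j`
otherwise. -/
def width (j : ℕ) : ℕ := if j = 0 then 1 else j

/-- The propagating envelope. -/
def envelope (lam : Multiset ℕ) : ℕ := (lam.map width).sum

/-- The elementary moves from an index down to a smaller one: lower a component by one, replace two
components by their sum, or delete a component equal to zero. -/
inductive Step : Multiset ℕ → Multiset ℕ → Prop
  | lower (m : ℕ) (s : Multiset ℕ) : Step ((m + 1) ::ₘ s) (m ::ₘ s)
  | merge (l m : ℕ) (s : Multiset ℕ) : Step (l ::ₘ m ::ₘ s) ((l + m) ::ₘ s)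
  | delete (s : Multiset ℕ) : Step (0 ::ₘ s) s

/-- The partial order `mu ≤ lam` on propagating indices. -/
def IndexLE (mu lam : Multiset ℕ) : Prop := Relation.ReflTransGen Step lam mu

/-- The strict order `mu < lam` on propagating indices. -/
def IndexLT (mu lam : Multiset ℕ) : Prop := IndexLE mu lam ∧ mu ≠ lam

/-! ### The special element of an index, and its permutation group -/

/-- The weakly decreasing list of an index. -/
def dominant (lam : Multiset ℕ) : List ℕ := lam.sort (fun a b => b ≤ a)

/-- Cut `0, 1, 2, …` into consecutive blocks of sizes `width l₀, width l₁, …`. This is the number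
of the block that contains `i`; it is the length of the list for all `i` beyond the last block. -/
def blockIdx : List ℕ → ℕ → ℕ
  | [], _ => 0
  | m :: l, i => if i < width m then 0 else blockIdx l (i - width m) + 1

/-- The number of the block of the node `i`. -/
def block (lam : Multiset ℕ) (i : Fin n) : ℕ := blockIdx (dominant lam) i

/-- The component of the index that belongs to the block of the node `i`, and `0` in the tail. -/
def comps (lam : Multiset ℕ) (i : Fin n) : ℕ := (dominant lam).getD (block lam i) 0

/-- The node `i` lies beyond all the blocks. -/
def IsTail (lam : Multiset ℕ) (i : Fin n) : Prop := (dominant lam).length ≤ block lam i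

/-- The node under a vertex of either row. -/
def node (v : Fin n ⊕ Fin n) : Fin n := Sum.elim id id v

/-- The special element of an index. Its outer parts are the unions of the two copies of a block,
and the singletons of the tail; its inner parts are the pairs `{i, i'}` for `i` in a block with
non-zero component, and otherwise singletons. -/
def special (n : ℕ) (lam : Multiset ℕ) : Diagram n where
  inner :=
    { r := fun v w => v = w ∨ (node v = node w ∧ comps lam (node v) ≠ 0)
      iseqv :=
        { refl := fun _ => Or.inl rfl
          symm := by
            rintro v w (h | ⟨h, h'⟩)
            · exact Or.inl h.symm
            · exact Or.inr ⟨h.symm, h ▸ h'⟩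
          trans := by
            rintro u v w (rfl | ⟨h, h'⟩) (rfl | ⟨g, g'⟩)
            · exact Or.inl rfl
            · exact Or.inr ⟨g, g'⟩
            · exact Or.inr ⟨h, h'⟩
            · exact Or.inr ⟨h.trans g, h'⟩ } }
  outer :=
    { r := fun v w => v = w ∨ (block lam (node v) = block lam (node w) ∧ ¬ IsTail lam (node v))
      iseqv :=
        { refl := fun _ => Or.inl rfl
          symm := by
            rintro v w (h | ⟨h, h'⟩)
            · exact Or.inl h.symm
            · exact Or.inr ⟨h.symm, by rwa [IsTail, ← h]⟩
          trans := by
            rintro u v w (rfl | ⟨h, h'⟩) (rfl | ⟨g, g'⟩)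
            · exact Or.inl rfl
            · exact Or.inr ⟨g, g'⟩
            · exact Or.inr ⟨h, h'⟩
            · exact Or.inr ⟨h.trans g, h'⟩ } }
  inner_le_outer := by
    rintro v w (h | ⟨h, h'⟩)
    · exact Or.inl h
    · refine Or.inr ⟨congrArg _ h, fun ht => h' ?_⟩
      exact List.getD_eq_default _ _ ht

/-- The permutation group `S[lam]`, a product of wreath products of symmetric groups: the
permutations of the nodes that permute blocks with equal components among each other, permute the
nodes inside the blocks, and fix the tail. -/
def symGroup (n : ℕ) (lam : Multiset ℕ) : Subgroup (Equiv.Perm (Fin n)) where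
  carrier := {σ | (∀ i j, block lam (σ i) = block lam (σ j) ↔ block lam i = block lam j) ∧
    (∀ i, comps lam (σ i) = comps lam i) ∧ ∀ i, IsTail lam i → σ i = i}
  one_mem' := ⟨fun _ _ => Iff.rfl, fun _ => rfl, fun _ _ => rfl⟩
  mul_mem' := by
    rintro σ τ ⟨h1, h2, h3⟩ ⟨g1, g2, g3⟩
    refine ⟨fun i j => ?_, fun i => ?_, fun i hi => ?_⟩
    · exact (h1 _ _).trans (g1 _ _)
    · exact (h2 _).trans (g2 _)
    · rw [Equiv.Perm.mul_apply, g3 i hi, h3 i hi]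
  inv_mem' := by
    rintro σ ⟨h1, h2, h3⟩
    refine ⟨fun i j => ?_, fun i => ?_, fun i hi => ?_⟩
    · simpa using (h1 (σ⁻¹ i) (σ⁻¹ j)).symm
    · simpa using (h2 (σ⁻¹ i)).symm
    · rw [Equiv.Perm.inv_eq_iff_eq, h3 i hi]

theorem comp_comm_permPart (σ : Equiv.Perm (Fin n)) (a : Setoid (Fin n ⊕ Fin n))
    (h : ∀ v w, a v w → a (Sum.map σ σ v) (Sum.map σ σ w))
    (h' : ∀ v w, a v w → a (Sum.map σ.symm σ.symm v) (Sum.map σ.symm σ.symm w)) :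
    comp (permPart σ) a = comp a (permPart σ) := by
  refine eq_of_wt fun s t => ?_
  rw [(permPart_comp σ a).2, (comp_permPart σ a).2]
  have e1 : ∀ v, Sum.elim s (t ∘ σ.symm) (Sum.map σ σ v) = Sum.elim (s ∘ σ) t v := by
    rintro (v | v) <;> simp
  have e2 : ∀ v, Sum.elim (s ∘ σ) t (Sum.map σ.symm σ.symm v) = Sum.elim s (t ∘ σ.symm) v := by
    rintro (v | v) <;> simp
  have : a ≤ Setoid.ker (Sum.elim (s ∘ σ) t) ↔ a ≤ Setoid.ker (Sum.elim s (t ∘ σ.symm)) := by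
    constructor
    · intro g v w hvw
      have := g (h' v w hvw)
      rwa [Setoid.ker_def, e2, e2] at this
    · intro g v w hvw
      have := g (h v w hvw)
      rwa [Setoid.ker_def, e1, e1] at this
  by_cases hc : a ≤ Setoid.ker (Sum.elim (s ∘ σ) t)
  · rw [wt, wt, if_pos hc, if_pos (this.1 hc)]
  · rw [wt, wt, if_neg hc, if_neg (fun hd => hc (this.2 hd))]

theorem node_map (σ : Equiv.Perm (Fin n)) (v : Fin n ⊕ Fin n) :
    node (Sum.map σ σ v) = σ (node v) := by
  rcases v with v | v <;> rfl

theorem special_inner_map {lam : Multiset ℕ} {σ : Equiv.Perm (Fin n)} (hσ : σ ∈ symGroup n lam)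
    (v w : Fin n ⊕ Fin n) (h : (special n lam).inner v w) :
    (special n lam).inner (Sum.map σ σ v) (Sum.map σ σ w) := by
  rcases h with h | ⟨h, h'⟩
  · exact Or.inl (congrArg _ h)
  · refine Or.inr ⟨?_, ?_⟩
    · rw [node_map, node_map, h]
    · rw [node_map, hσ.2.1]
      exact h'

theorem special_outer_map {lam : Multiset ℕ} {σ : Equiv.Perm (Fin n)} (hσ : σ ∈ symGroup n lam)
    (v w : Fin n ⊕ Fin n) (h : (special n lam).outer v w) :
    (special n lam).outer (Sum.map σ σ v) (Sum.map σ σ w) := by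
  rcases h with h | ⟨h, h'⟩
  · exact Or.inl (congrArg _ h)
  · refine Or.inr ⟨?_, ?_⟩
    · rw [node_map, node_map]
      exact (hσ.1 _ _).2 h
    · rw [node_map]
      intro ht
      refine h' ?_
      have := σ.injective (hσ.2.2 _ ht)
      rwa [this] at ht

/-- The elements of `S[lam]` commute with the special element of `lam`. -/
theorem perm_mul_special {lam : Multiset ℕ} {σ : Equiv.Perm (Fin n)} (hσ : σ ∈ symGroup n lam) :
    (Diagram.perm σ).mul (special n lam) = (special n lam).mul (Diagram.perm σ) := by
  have hσ' : σ.symm ∈ symGroup n lam := (symGroup n lam).inv_mem hσ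
  refine Diagram.ext ?_ ?_
  · exact comp_comm_permPart σ _ (special_inner_map hσ) (special_inner_map hσ')
  · exact comp_comm_permPart σ _ (special_outer_map hσ) (special_outer_map hσ')

/-! ### Sections, and the standard modules -/

section Standard

variable (Q₁ Q₂ : k) (n : ℕ) (lam : Multiset ℕ)

open Alg

theorem permHom_mul_special (σ : symGroup n lam) :
    permHom Q₁ Q₂ n σ * basis Q₁ Q₂ (special n lam) =
      basis Q₁ Q₂ (special n lam) * permHom Q₁ Q₂ n σ := by
  have h1 : permHom Q₁ Q₂ n σ * basis Q₁ Q₂ (special n lam) =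
      basis Q₁ Q₂ ((Diagram.perm σ.1).mul (special n lam)) :=
    (mulHom_basis _ _).trans (basisMul_perm_left _ _)
  have h2 : basis Q₁ Q₂ (special n lam) * permHom Q₁ Q₂ n σ =
      basis Q₁ Q₂ ((special n lam).mul (Diagram.perm σ.1)) :=
    (mulHom_basis _ _).trans (basisMul_perm_right _ _)
  rw [h1, h2, perm_mul_special σ.2]

/-- The two-sided ideal generated by the diagrams of propagating index less than `lam`, as a left
ideal. -/
def lowerIdeal : Submodule (Alg Q₁ Q₂ n) (Alg Q₁ Q₂ n) :=
  Submodule.span _ {x | ∃ (a : Diagram n) (y : Alg Q₁ Q₂ n),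
    IndexLT (propIndex a) lam ∧ x = basis Q₁ Q₂ a * y}

/-- The left module `P[lam]'`: the image of the left ideal generated by the special element of
`lam` in the quotient by the diagrams of index less than `lam`. It lies in the `lam` section, which
is the image in this quotient of the ideal of diagrams of index at most `lam`. -/
def sectionColumn : Submodule (Alg Q₁ Q₂ n) (Alg Q₁ Q₂ n ⧸ lowerIdeal Q₁ Q₂ n lam) :=
  (Submodule.span (Alg Q₁ Q₂ n) {basis Q₁ Q₂ (special n lam)}).map (lowerIdeal Q₁ Q₂ n lam).mkQ

/-- Right multiplication by `y` on `P`, as a map of left modules. -/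
def rightMul (y : Alg Q₁ Q₂ n) : Alg Q₁ Q₂ n →ₗ[Alg Q₁ Q₂ n] Alg Q₁ Q₂ n :=
  LinearMap.toSpanSingleton _ _ y

theorem rightMul_apply (x y : Alg Q₁ Q₂ n) : rightMul Q₁ Q₂ n y x = x * y := rfl

theorem lowerIdeal_le_comap (y : Alg Q₁ Q₂ n) :
    lowerIdeal Q₁ Q₂ n lam ≤ (lowerIdeal Q₁ Q₂ n lam).comap (rightMul Q₁ Q₂ n y) := by
  refine Submodule.span_le.2 ?_
  rintro _ ⟨a, z, ha, rfl⟩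
  refine Submodule.subset_span ⟨a, z * y, ha, ?_⟩
  rw [rightMul_apply, mul_assoc]

/-- Right multiplication by `y` on the quotient by the diagrams of index less than `lam`. -/
def rightMulQ (y : Alg Q₁ Q₂ n) :
    (Alg Q₁ Q₂ n ⧸ lowerIdeal Q₁ Q₂ n lam) →ₗ[Alg Q₁ Q₂ n]
      (Alg Q₁ Q₂ n ⧸ lowerIdeal Q₁ Q₂ n lam) :=
  (lowerIdeal Q₁ Q₂ n lam).mapQ _ (rightMul Q₁ Q₂ n y) (lowerIdeal_le_comap Q₁ Q₂ n lam y)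

theorem rightMulQ_mk (x y : Alg Q₁ Q₂ n) :
    rightMulQ Q₁ Q₂ n lam y (Submodule.Quotient.mk x) = Submodule.Quotient.mk (x * y) := rfl

theorem rightMulQ_mem (σ : symGroup n lam) :
    ∀ m ∈ sectionColumn Q₁ Q₂ n lam,
      rightMulQ Q₁ Q₂ n lam (permHom Q₁ Q₂ n σ) m ∈ sectionColumn Q₁ Q₂ n lam := by
  rintro _ ⟨x, hx, rfl⟩
  obtain ⟨y, rfl⟩ := Submodule.mem_span_singleton.1 hx
  refine ⟨(y * permHom Q₁ Q₂ n σ) • basis Q₁ Q₂ (special n lam),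
    Submodule.smul_mem _ _ (Submodule.mem_span_singleton_self _), ?_⟩
  rw [Submodule.mkQ_apply, Submodule.mkQ_apply, rightMulQ_mk, smul_eq_mul, smul_eq_mul, mul_assoc,
    mul_assoc, permHom_mul_special]

/-- The right action of `S[lam]` on `P[lam]'` by right multiplication. -/
def rightPerm :
    symGroup n lam →* (Module.End (Alg Q₁ Q₂ n) (sectionColumn Q₁ Q₂ n lam))ᵐᵒᵖ where
  toFun σ := MulOpposite.op
    ((rightMulQ Q₁ Q₂ n lam (permHom Q₁ Q₂ n σ)).restrict (rightMulQ_mem Q₁ Q₂ n lam σ))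
  map_one' := by
    rw [← MulOpposite.op_one]
    congr 1
    refine LinearMap.ext fun m => Subtype.ext ?_
    obtain ⟨m, hm⟩ := m
    obtain ⟨x, rfl⟩ := Submodule.Quotient.mk_surjective _ m
    change rightMulQ Q₁ Q₂ n lam (permHom Q₁ Q₂ n 1) (Submodule.Quotient.mk x) = _
    rw [rightMulQ_mk, map_one, mul_one]
    rfl
  map_mul' σ τ := by
    rw [← MulOpposite.op_mul]
    congr 1
    refine LinearMap.ext fun m => Subtype.ext ?_
    obtain ⟨m, hm⟩ := m
    obtain ⟨x, rfl⟩ := Submodule.Quotient.mk_surjective _ m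
    change rightMulQ Q₁ Q₂ n lam (permHom Q₁ Q₂ n (σ.1 * τ.1)) (Submodule.Quotient.mk x) =
      rightMulQ Q₁ Q₂ n lam (permHom Q₁ Q₂ n τ)
        (rightMulQ Q₁ Q₂ n lam (permHom Q₁ Q₂ n σ) (Submodule.Quotient.mk x))
    rw [rightMulQ_mk, rightMulQ_mk, rightMulQ_mk, map_mul, mul_assoc]

/-- `P[lam]'` as a right module over the group algebra `k S[lam]`. -/
instance : Module (MonoidAlgebra k (symGroup n lam))ᵐᵒᵖ (sectionColumn Q₁ Q₂ n lam) :=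
  Module.compHom _ (AlgHom.opComm
    (MonoidAlgebra.lift k _ _ (rightPerm Q₁ Q₂ n lam))).toRingHom

end Standard

/-! ### The tensor product over a non-commutative algebra -/

section Balanced

variable (k) (A R M L : Type*) [Ring A] [Algebra k A] [Ring R] [Algebra k R]
  [AddCommGroup M] [Module k M] [Module A M] [IsScalarTower k A M] [Module Rᵐᵒᵖ M]
  [AddCommGroup L] [Module k L] [Module R L]

/-- The relations `m r ⊗ l = m ⊗ r l`. -/
def balancedRel : Submodule A (M ⊗[k] L) :=
  Submodule.span A {t | ∃ (m : M) (r : R) (l : L),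
    t = (MulOpposite.op r • m) ⊗ₜ[k] l - m ⊗ₜ[k] (r • l)}

/-- The left `A`-module `M ⊗_R L`, for a left `A`- and right `R`-module `M` and a left `R`-module
`L`, where `A` and `R` are `k`-algebras. -/
abbrev BalancedTensor : Type _ := (M ⊗[k] L) ⧸ balancedRel k A R M L

end Balanced

/-- The standard module `P[lam]' ⊗_{k S[lam]} L`, a left module over `P_n^{(2)}(Q₁, Q₂)`. -/
abbrev StandardModule (Q₁ Q₂ : k) (n : ℕ) (lam : Multiset ℕ) (L : Type*) [AddCommGroup L]
    [Module k L] [Module (MonoidAlgebra k (symGroup n lam)) L] : Type _ :=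
  BalancedTensor k (Alg Q₁ Q₂ n) (MonoidAlgebra k (symGroup n lam))
    (sectionColumn Q₁ Q₂ n lam) L

end RamifiedPartition

end

namespace RamifiedPartition

section

/-! ### The order on propagating indices -/

/-! Write I for the special element. Since the envelope is n, the blocks exhaust all nodes and I has
no tail, so there is no room for anything outside the propagating structure.

Rigidity: in a product D I the lower nodes keep at least the outer connections of I, and the inner
singletons of the components 0 stay singletons. Hence the index of D I is at most lam
(`IsSpecialBelow.indexLE`). If it equals lam, counting leaves each block in its own propagating
outer part and each node of a non-zero component in its own propagating inner part. Choosing upper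
ends then gives an injection of the n nodes into the n nodes, and D I = σ I for a permutation σ
(`IsSpecialBelow.exists_perm`). If the index is smaller, D I vanishes in the quotient. So P[lam]' is
spanned by the classes of σ I, and every vector of the standard module is a sum of terms c I ⊗ f(c)
over coset representatives c of S[lam] in the symmetric group (`exists_coset_sum`).

Separation of cosets: I σ I has index lam only if σ lies in S[lam] (`mem_symGroup_of_propIndex_eq`),
so I kills σ I otherwise. Moreover I I is a power of Q_inner times I: a component 0 leaves an inner
loop in the middle row, while every outer part of the middle reaches the outside rows. Multiplying a
non-zero vector by I c₀⁻¹ therefore isolates a non-zero multiple of I ⊗ f(c₀), which generates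
everything because L is simple and I generates the column.

Non-vanishing: the number of outer and inner propagating parts together drops strictly along the
order on indices and never grows in a product, so no σ I occurs in an element of the lower ideal.
Reading off the coefficients of s I for s in S[lam] gives a balanced functional with I ⊗ l ↦ l
(`toSimple`), and the module is non-zero. -/

theorem Step.add {s t : Multiset ℕ} (h : Step s t) (u : Multiset ℕ) : Step (s + u) (t + u) := by
  cases h with
  | lower m s => simpa using Step.lower m (s + u)
  | merge l m s => simpa using Step.merge l m (s + u)
  | delete _ => simpa using Step.delete (t + u)

theorem IndexLE.refl (s : Multiset ℕ) : IndexLE s s := Relation.ReflTransGen.refl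

theorem IndexLE.trans {s t u : Multiset ℕ} (h : IndexLE s t) (h' : IndexLE t u) : IndexLE s u :=
  Relation.ReflTransGen.trans h' h

theorem IndexLE.add_right {s t : Multiset ℕ} (h : IndexLE s t) (u : Multiset ℕ) :
    IndexLE (s + u) (t + u) := by
  induction h with
  | refl => exact IndexLE.refl _
  | tail _ h ih => exact ih.tail (Step.add h u)

theorem IndexLE.add {s t s' t' : Multiset ℕ} (h : IndexLE s t) (h' : IndexLE s' t') :
    IndexLE (s + s') (t + t') := by
  refine (h.add_right s').trans ?_
  rw [add_comm t, add_comm t]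
  exact h'.add_right t

theorem IndexLE.sum {ι : Type*} (A : Finset ι) {s t : ι → Multiset ℕ}
    (h : ∀ i ∈ A, IndexLE (s i) (t i)) : IndexLE (∑ i ∈ A, s i) (∑ i ∈ A, t i) := by
  classical
  induction A using Finset.induction_on with
  | empty => exact IndexLE.refl _
  | insert a A ha ih =>
    rw [Finset.sum_insert ha, Finset.sum_insert ha]
    exact (h a (Finset.mem_insert_self _ _)).add
      (ih fun i hi => h i (Finset.mem_insert_of_mem hi))

theorem indexLE_singleton {m l : ℕ} (h : m ≤ l) : IndexLE {m} {l} := by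
  induction h with
  | refl => exact IndexLE.refl _
  | step _ ih => exact Relation.ReflTransGen.head (Step.lower _ 0) ih

theorem indexLE_zero (s : Multiset ℕ) : IndexLE 0 s := by
  induction s using Multiset.induction_on with
  | empty => exact IndexLE.refl _
  | cons m s ih =>
    rw [← Multiset.singleton_add]
    have h : IndexLE 0 {m} :=
      Relation.ReflTransGen.tail (indexLE_singleton (Nat.zero_le m)) (Step.delete 0)
    simpa using h.add ih

/-- Merge all components into one. The empty index must be excluded: its sum would be a component 0,
and no step creates a component. -/
theorem indexLE_singleton_sum {s : Multiset ℕ} (hs : s ≠ 0) : IndexLE {s.sum} s := by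
  induction s using Multiset.induction_on with
  | empty => exact absurd rfl hs
  | cons m s ih =>
    by_cases h : s = 0
    · subst h
      simpa using IndexLE.refl {m}
    · have h1 : IndexLE (m ::ₘ {s.sum}) (m ::ₘ s) := by
        simpa [Multiset.singleton_add] using (IndexLE.refl {m}).add (ih h)
      rw [Multiset.sum_cons]
      exact IndexLE.trans (Relation.ReflTransGen.single (Step.merge m s.sum 0)) h1

theorem map_eq_sum_singleton {ι : Type*} (A : Finset ι) (g : ι → ℕ) :
    A.val.map g = ∑ i ∈ A, {g i} := by
  rw [← Multiset.sum_map_singleton (A.val.map g), Multiset.map_map]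
  rfl

/-- An index is lowered by distributing its components over the components of another one. -/
theorem indexLE_of_fibers {ι κ : Type*} [Fintype ι] [Fintype κ] (lam : ι → ℕ) (mu : κ → ℕ)
    (f : ι → Option κ) (hf : ∀ q, ∃ i, f i = some q) [DecidableEq κ]
    (hmu : ∀ q, mu q ≤ ∑ i with f i = some q, lam i) :
    IndexLE (Finset.univ.val.map mu) (Finset.univ.val.map lam) := by
  -- Group the components by their fibre under `f`. The fibre over `none` is lowered to nothing;
  -- every other fibre is merged into its sum and then lowered to `mu q`. Surjectivity onto the
  -- `some q` makes the merged fibres non-empty.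
  rw [map_eq_sum_singleton, map_eq_sum_singleton, ← Finset.sum_fiberwise (s := Finset.univ) (g := f) (f := fun i => {lam i}),
    Fintype.sum_option, ← zero_add (∑ i, {mu i})]
  refine (indexLE_zero _).add (IndexLE.sum _ fun q _ => ?_)
  refine (indexLE_singleton (hmu q)).trans ?_
  rw [← map_eq_sum_singleton]
  refine indexLE_singleton_sum ?_
  obtain ⟨i, hi⟩ := hf q
  intro h0
  have : lam i ∈ (0 : Multiset ℕ) := h0 ▸ Multiset.mem_map_of_mem lam (by simpa using hi)
  exact absurd this (Multiset.notMem_zero _)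

/-- Lowering decreases the sum, while merging and deleting decrease the number of components and
keep the sum. The total is thus a strictly monotone numerical shadow of the order, and it can be
counted on diagrams. -/
theorem Step.card_add_sum_lt {s t : Multiset ℕ} (h : Step s t) :
    t.card + t.sum < s.card + s.sum := by
  cases h <;> (simp; try omega)

theorem IndexLT.card_add_sum_lt {s t : Multiset ℕ} (h : IndexLT s t) :
    s.card + s.sum < t.card + t.sum := by
  obtain ⟨h, hne⟩ := h
  have key : ∀ {s}, IndexLE s t → s = t ∨ s.card + s.sum < t.card + t.sum := by
    intro s h
    induction h with
    | refl => exact Or.inl rfl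
    | tail _ h' ih =>
      right
      rcases ih with rfl | ih
      · exact Step.card_add_sum_lt h'
      · exact (Step.card_add_sum_lt h').trans ih
  exact (key h).resolve_left hne

/-! ### Blocks of nodes -/

theorem blockIdx_lt_length : ∀ (l : List ℕ) (j : ℕ), j < (l.map width).sum →
    blockIdx l j < l.length
  | [], j, h => by simp at h
  | m :: l, j, h => by
    rw [blockIdx]
    split_ifs with hj
    · simp
    · rw [List.map_cons, List.sum_cons] at h
      have := blockIdx_lt_length l (j - width m) (by omega)
      simpa using this

theorem card_blockIdx : ∀ (l : List ℕ) (i : ℕ) (hi : i < l.length),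
    ((Finset.range (l.map width).sum).filter fun j => blockIdx l j = i).card = width l[i]
  | m :: l, 0, _ => by
    rw [← Finset.card_range (width (m :: l)[0])]
    congr 1
    ext j
    simp only [Finset.mem_filter, Finset.mem_range, blockIdx, List.map_cons, List.sum_cons,
      List.getElem_cons_zero]
    split_ifs with h <;> simp <;> omega
  | m :: l, i + 1, hi => by
    have hi' : i < l.length := by simpa using hi
    rw [List.getElem_cons_succ, ← card_blockIdx l i hi']
    -- Block `i + 1` of `m :: l` is block `i` of `l` translated by the width of the first block.
    refine Eq.trans ?_ (Finset.card_map (addLeftEmbedding (width m)))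
    congr 1
    ext j
    simp only [Finset.mem_filter, Finset.mem_range, blockIdx, List.map_cons, List.sum_cons,
      Finset.mem_map, addLeftEmbedding_apply]
    constructor
    · rintro ⟨h1, h2⟩
      split_ifs at h2 with h
      exact ⟨j - width m, ⟨by omega, by omega⟩, by omega⟩
    · rintro ⟨x, ⟨h1, h2⟩, rfl⟩
      refine ⟨by omega, ?_⟩
      rw [if_neg (by omega), Nat.add_sub_cancel_left, h2]

variable {n : ℕ} {lam : Multiset ℕ}

theorem sum_map_width_dominant (lam : Multiset ℕ) :
    ((dominant lam).map width).sum = envelope lam := by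
  rw [envelope, ← Multiset.sum_coe, ← Multiset.map_coe, dominant, Multiset.sort_eq]

theorem block_lt_length (henv : envelope lam = n) (j : Fin n) :
    block lam j < (dominant lam).length :=
  blockIdx_lt_length _ _ (by rw [sum_map_width_dominant, henv]; exact j.2)

theorem not_isTail (henv : envelope lam = n) (j : Fin n) : ¬ IsTail lam j :=
  not_le.2 (block_lt_length henv j)

theorem comps_eq_getElem (henv : envelope lam = n) (j : Fin n) :
    comps lam j = (dominant lam)[block lam j]'(block_lt_length henv j) :=
  List.getD_eq_getElem _ _ _

theorem comps_congr {i j : Fin n} (h : block lam i = block lam j) :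
    comps lam i = comps lam j := by
  rw [comps, comps, h]

theorem card_block (henv : envelope lam = n) {i : ℕ} (hi : i < (dominant lam).length) :
    (Finset.univ.filter fun j : Fin n => block lam j = i).card = width (dominant lam)[i] := by
  rw [← card_blockIdx _ i hi, sum_map_width_dominant, henv,
    ← Finset.card_map Fin.valEmbedding]
  congr 1
  ext j
  simp only [Finset.mem_map, Finset.mem_filter, Finset.mem_univ, true_and, Finset.mem_range,
    Fin.valEmbedding_apply]
  constructor
  · rintro ⟨x, h, rfl⟩
    exact ⟨x.2, h⟩
  · rintro ⟨h1, h2⟩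
    exact ⟨⟨j, h1⟩, h2, rfl⟩

theorem exists_block_eq (henv : envelope lam = n) {i : ℕ} (hi : i < (dominant lam).length) :
    ∃ j : Fin n, block lam j = i := by
  have h : 0 < (Finset.univ.filter fun j : Fin n => block lam j = i).card := by
    rw [card_block henv hi, width]
    split_ifs <;> omega
  obtain ⟨j, hj⟩ := Finset.card_pos.1 h
  exact ⟨j, (Finset.mem_filter.1 hj).2⟩

/-- The block of a component 0 has width 1, so it is a single node. -/
theorem eq_of_block_eq (henv : envelope lam = n) {i j : Fin n} (h : block lam i = block lam j)
    (h0 : comps lam i = 0) : i = j := by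
  have hc := card_block henv (block_lt_length henv i)
  rw [← comps_eq_getElem henv, h0, width, if_pos rfl] at hc
  exact Finset.card_le_one.1 hc.le i (by simp) j (by simp [h])

/-- Width and component differ only at the component 0, whose one node is removed by the filter. -/
theorem card_block_ne_zero (henv : envelope lam = n) {i : ℕ} (hi : i < (dominant lam).length) :
    (Finset.univ.filter fun j : Fin n => block lam j = i ∧ comps lam j ≠ 0).card =
      (dominant lam)[i] := by
  by_cases h0 : (dominant lam)[i] = 0
  · rw [h0, Finset.card_eq_zero, Finset.filter_eq_empty_iff]
    rintro j - ⟨rfl, h⟩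
    exact h ((comps_eq_getElem henv j).trans h0)
  · have := card_block henv hi
    rw [width, if_neg h0] at this
    rw [← this]
    congr 1
    ext j
    simp only [Finset.mem_filter, Finset.mem_univ, true_and, and_iff_left_iff_imp]
    rintro rfl
    rwa [comps_eq_getElem henv]

theorem length_dominant (lam : Multiset ℕ) : (dominant lam).length = lam.card :=
  Multiset.length_sort _

theorem map_get_dominant (lam : Multiset ℕ) :
    (Finset.univ : Finset (Fin (dominant lam).length)).val.map (fun i => (dominant lam)[i]) =
      lam := by
  conv_rhs => rw [← Multiset.sort_eq lam (fun a b => b ≤ a)]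
  rw [Fin.univ_val_map]
  exact congrArg _ List.ofFn_getElem

theorem card_comps_ne_zero (henv : envelope lam = n) :
    (Finset.univ.filter fun j : Fin n => comps lam j ≠ 0).card = lam.sum := by
  have h1 : lam.sum = ∑ i : Fin (dominant lam).length, (dominant lam)[i] := by
    conv_lhs => rw [← map_get_dominant lam]
    rfl
  rw [h1, Finset.card_eq_sum_card_fiberwise
    (f := fun j => (⟨block lam j, block_lt_length henv j⟩ : Fin (dominant lam).length))
    (t := Finset.univ) (fun _ _ => Finset.mem_coe.2 (Finset.mem_univ _))]
  refine Finset.sum_congr rfl fun i _ => ?_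
  refine Eq.trans ?_ (card_block_ne_zero henv i.2)
  rw [Finset.filter_filter]
  congr 1
  ext j
  simp [Fin.ext_iff, and_comm]

end

section

/-! ### Propagating parts of composites -/

section CompLemmas

variable {X Y Z : Type*} {a : Setoid (X ⊕ Y)} {b : Setoid (Y ⊕ Z)}

theorem stack_left {v w : X ⊕ Y} (h : a v w) :
    stack a b (Sum.elim (fun x => Sum.inl (Sum.inl x)) Sum.inr v)
      (Sum.elim (fun x => Sum.inl (Sum.inl x)) Sum.inr w) :=
  (le_sup_left : _ ≤ stack a b) (Setoid.le_comap_map h)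

theorem stack_right {v w : Y ⊕ Z} (h : b v w) :
    stack a b (Sum.elim Sum.inr (fun z => Sum.inl (Sum.inr z)) v)
      (Sum.elim Sum.inr (fun z => Sum.inl (Sum.inr z)) w) :=
  (le_sup_right : _ ≤ stack a b) (Setoid.le_comap_map h)

theorem comp_inl_inl {x x' : X} (h : a (Sum.inl x) (Sum.inl x')) :
    comp a b (Sum.inl x) (Sum.inl x') :=
  stack_left (b := b) h

theorem comp_inr_inr {z z' : Z} (h : b (Sum.inr z) (Sum.inr z')) :
    comp a b (Sum.inr z) (Sum.inr z') :=
  stack_right (a := a) h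

theorem comp_inl_inr {x : X} {y : Y} {z : Z} (h : a (Sum.inl x) (Sum.inr y))
    (h' : b (Sum.inl y) (Sum.inr z)) : comp a b (Sum.inl x) (Sum.inr z) :=
  (stack a b).trans' (stack_left h) (stack_right h')

theorem stack_le_ker_iff {C : Type*} (φ : (X ⊕ Z) ⊕ Y → C) :
    stack a b ≤ Setoid.ker φ ↔
      a ≤ Setoid.ker (φ ∘ Sum.elim (fun x => Sum.inl (Sum.inl x)) Sum.inr) ∧
        b ≤ Setoid.ker (φ ∘ Sum.elim Sum.inr (fun z => Sum.inl (Sum.inr z))) := by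
  rw [stack, sup_le_iff, map_le_ker, map_le_ker]

/-- A bottom vertex that is not connected upwards is only connected to the bottom vertices of its
part. -/
theorem comp_inr_of_forall_not {z : Z} (hz : ∀ y, ¬ b (Sum.inl y) (Sum.inr z)) {v : X ⊕ Z}
    (h : comp a b (Sum.inr z) v) : ∃ z', v = Sum.inr z' ∧ b (Sum.inr z) (Sum.inr z') := by
  -- The indicator of the part of `z` in the lower layer. It misses the middle row by assumption, so
  -- it is constant on the parts of both layers, hence on those of the stack.
  let φ : (X ⊕ Z) ⊕ Y → Prop :=
    Sum.elim (Sum.elim (fun _ => False) fun z' => b (Sum.inr z) (Sum.inr z')) fun _ => False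
  have hφ : stack a b ≤ Setoid.ker φ := by
    rw [stack_le_ker_iff]
    constructor
    · rintro (v | v) (w | w) - <;> rfl
    · have key : φ ∘ Sum.elim Sum.inr (fun z => Sum.inl (Sum.inr z)) = fun w => b (Sum.inr z) w := by
        funext w
        rcases w with w | w
        · exact propext ⟨False.elim, fun h => hz w (b.symm' h)⟩
        · rfl
      rw [key]
      intro v w hvw
      exact propext ⟨fun h => b.trans' h hvw, fun h => b.trans' h (b.symm' hvw)⟩
  have h1 : φ (Sum.inl (Sum.inr z)) = φ (Sum.inl v) := hφ h
  have h2 : φ (Sum.inl v) := h1 ▸ b.refl' _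
  rcases v with v | v
  · exact h2.elim
  · exact ⟨v, rfl, h2⟩

/-- A top vertex that is not connected downwards is only connected to the top vertices of its
part. -/
theorem comp_inl_of_forall_not {x : X} (hx : ∀ y, ¬ a (Sum.inl x) (Sum.inr y)) {v : X ⊕ Z}
    (h : comp a b (Sum.inl x) v) : ∃ x', v = Sum.inl x' ∧ a (Sum.inl x) (Sum.inl x') := by
  let φ : (X ⊕ Z) ⊕ Y → Prop :=
    Sum.elim (Sum.elim (fun x' => a (Sum.inl x) (Sum.inl x')) fun _ => False) fun _ => False
  have hφ : stack a b ≤ Setoid.ker φ := by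
    rw [stack_le_ker_iff]
    constructor
    · have key : φ ∘ Sum.elim (fun x => Sum.inl (Sum.inl x)) Sum.inr = fun w => a (Sum.inl x) w := by
        funext w
        rcases w with w | w
        · rfl
        · exact propext ⟨False.elim, fun h => hx w h⟩
      rw [key]
      intro v w hvw
      exact propext ⟨fun h => a.trans' h hvw, fun h => a.trans' h (a.symm' hvw)⟩
    · rintro (v | v) (w | w) - <;> rfl
  have h1 : φ (Sum.inl (Sum.inl x)) = φ (Sum.inl v) := hφ h
  have h2 : φ (Sum.inl v) := h1 ▸ a.refl' _
  rcases v with v | v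
  · exact ⟨v, rfl, h2⟩
  · exact h2.elim

theorem exists_right_of_comp {x : X} {z : Z} (h : comp a b (Sum.inl x) (Sum.inr z)) :
    ∃ y, b (Sum.inl y) (Sum.inr z) := by
  by_contra! hc
  obtain ⟨z', h', -⟩ := comp_inr_of_forall_not hc ((comp a b).symm' h)
  cases h'

theorem exists_left_of_comp {x : X} {z : Z} (h : comp a b (Sum.inl x) (Sum.inr z)) :
    ∃ y, a (Sum.inl x) (Sum.inr y) := by
  by_contra! hc
  obtain ⟨z', h', -⟩ := comp_inl_of_forall_not hc h
  cases h'

theorem permPart_comp_eq [Finite X] [Finite Z] (σ : Equiv.Perm X) (a : Setoid (X ⊕ Z)) :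
    comp (permPart σ) a = a.comap (Sum.map σ.symm id) := by
  refine eq_of_wt fun s t => ?_
  rw [(permPart_comp σ a).2]
  have h : a ≤ Setoid.ker (Sum.elim (s ∘ σ) t) ↔
      a.comap (Sum.map σ.symm id) ≤ Setoid.ker (Sum.elim s t) := by
    have e1 : ∀ v, Sum.elim (s ∘ σ) t (Sum.map σ.symm id v) = Sum.elim s t v := by
      rintro (v | v) <;> simp
    have e2 : ∀ v, Sum.map σ.symm id (Sum.map σ id v) = (v : X ⊕ Z) := by
      rintro (v | v) <;> simp
    constructor
    · intro g v w hvw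
      have := g hvw
      rwa [Setoid.ker_def, e1, e1] at this
    · intro g v w hvw
      have : a.comap (Sum.map σ.symm id) (Sum.map σ id v) (Sum.map σ id w) := by
        rw [Setoid.comap_rel, e2, e2]
        exact hvw
      have := g this
      rwa [Setoid.ker_def, ← e1, ← e1, e2, e2] at this
  by_cases hc : a ≤ Setoid.ker (Sum.elim (s ∘ σ) t)
  · rw [wt, wt, if_pos hc, if_pos (h.1 hc)]
  · rw [wt, wt, if_neg hc, if_neg fun hd => hc (h.2 hd)]

end CompLemmas

/-! ### Monotonicity of the number of propagating parts -/

variable {n : ℕ}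

/-- A propagating part of the composite has a bottom vertex, whose part in `b` must reach the middle
row. This part of `b` determines the part of the composite, so the choice is injective. -/
theorem card_propPart_comp_le_right (a b : Setoid (Fin n ⊕ Fin n)) :
    Nat.card (PropPart (comp a b)) ≤ Nat.card (PropPart b) := by
  have h : ∀ q : PropPart (comp a b), ∃ z, Quotient.mk (comp a b) (Sum.inr z) = q.1 ∧
      ∃ y, Quotient.mk b (Sum.inl y) = Quotient.mk b (Sum.inr z) := by
    rintro ⟨q, ⟨x, hx⟩, z, hz⟩
    obtain ⟨y, hy⟩ := exists_right_of_comp (Quotient.exact (hx.trans hz.symm))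
    exact ⟨z, hz, y, Quotient.sound hy⟩
  choose f hf g hg using h
  refine Nat.card_le_card_of_injective
    (fun q => (⟨Quotient.mk b (Sum.inr (f q)), ⟨g q, hg q⟩, f q, rfl⟩ : PropPart b)) ?_
  intro p q hpq
  refine Subtype.ext ?_
  rw [← hf p, ← hf q]
  exact Quotient.sound (comp_inr_inr (Quotient.exact (congrArg Subtype.val hpq)))

theorem card_propPart_comp_le_left (a b : Setoid (Fin n ⊕ Fin n)) :
    Nat.card (PropPart (comp a b)) ≤ Nat.card (PropPart a) := by
  have h : ∀ q : PropPart (comp a b), ∃ x, Quotient.mk (comp a b) (Sum.inl x) = q.1 ∧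
      ∃ y, Quotient.mk a (Sum.inr y) = Quotient.mk a (Sum.inl x) := by
    rintro ⟨q, ⟨x, hx⟩, z, hz⟩
    obtain ⟨y, hy⟩ := exists_left_of_comp (Quotient.exact (hx.trans hz.symm))
    exact ⟨x, hx, y, (Quotient.sound hy).symm⟩
  choose f hf g hg using h
  refine Nat.card_le_card_of_injective
    (fun q => (⟨Quotient.mk a (Sum.inl (f q)), ⟨f q, rfl⟩, g q, hg q⟩ : PropPart a)) ?_
  intro p q hpq
  refine Subtype.ext ?_
  rw [← hf p, ← hf q]
  exact Quotient.sound (comp_inl_inl (Quotient.exact (congrArg Subtype.val hpq)))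

theorem card_propIndex (a : Diagram n) :
    (propIndex a).card = Nat.card (PropPart a.outer) := by
  let := Fintype.ofFinite (PropPart a.outer)
  rw [propIndex, Multiset.card_map, Finset.card_val, Nat.card_eq_fintype_card, Finset.card_univ]

/-- An inner propagating part lies in an outer part that is itself propagating, so the fibres
counted by `legs` cover all inner propagating parts. -/
theorem sum_propIndex (a : Diagram n) :
    (propIndex a).sum = Nat.card (PropPart a.inner) := by
  let := Fintype.ofFinite (PropPart a.outer)
  have h : ∀ p : PropPart a.inner,
      (∃ i, Quotient.mk a.outer (Sum.inl i) = Setoid.map_of_le a.inner_le_outer p.1) ∧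
        ∃ j, Quotient.mk a.outer (Sum.inr j) = Setoid.map_of_le a.inner_le_outer p.1 := by
    rintro ⟨p, ⟨i, hi⟩, j, hj⟩
    exact ⟨⟨i, congrArg (Setoid.map_of_le a.inner_le_outer) hi⟩,
      j, congrArg (Setoid.map_of_le a.inner_le_outer) hj⟩
  let F : PropPart a.inner → PropPart a.outer := fun p => ⟨_, h p⟩
  have e := Nat.card_congr (Equiv.sigmaFiberEquiv F)
  rw [Nat.card_sigma] at e
  rw [← e, propIndex]
  refine Finset.sum_congr rfl fun q _ => ?_
  exact Nat.card_congr (Equiv.subtypeEquivRight fun p =>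
    (Subtype.ext_iff (a1 := F p) (a2 := q)).symm)

/-- The total number of inner and outer propagating parts. -/
noncomputable def propCount (a : Diagram n) : ℕ :=
  Nat.card (PropPart a.outer) + Nat.card (PropPart a.inner)

theorem card_add_sum_propIndex (a : Diagram n) :
    (propIndex a).card + (propIndex a).sum = propCount a := by
  rw [card_propIndex, sum_propIndex, propCount]

theorem propCount_mul_le_left (a b : Diagram n) : propCount (a.mul b) ≤ propCount a :=
  add_le_add (card_propPart_comp_le_left _ _) (card_propPart_comp_le_left _ _)

theorem propCount_mul_le_right (a b : Diagram n) : propCount (a.mul b) ≤ propCount b :=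
  add_le_add (card_propPart_comp_le_right _ _) (card_propPart_comp_le_right _ _)

end

section

/-! ### Diagrams whose lower half is that of a special element -/

/-- If there are as many parts with a property `P` as there are blocks, and every such part is a
union of blocks, then all blocks lie in distinct parts with that property. -/
theorem forall_of_card_le {J B Q : Type*} [Finite B] (β : J → B)
    (c : J → Q) (P : Q → Prop) (hc : ∀ i j, β i = β j → c i = c j)
    (hP : ∀ q, P q → ∃ j, c j = q) (hcard : Nat.card B ≤ Nat.card {q // P q}) :
    (∀ j, P (c j)) ∧ ∀ i j, c i = c j → β i = β j := by
  choose g hg using hP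
  -- Pick one block in each part. A block lies in only one part, so the choice is injective; the
  -- cardinality bound makes it surjective, and each block is then the one picked for its own part.
  let G : {q // P q} → B := fun q => β (g q.1 q.2)
  have hinj : Function.Injective G := fun p q h =>
    Subtype.ext (by rw [← hg p.1 p.2, ← hg q.1 q.2]; exact hc _ _ h)
  have hsurj := (hinj.bijective_of_nat_card_le hcard).2
  have key : ∀ j, ∃ q, G q = β j ∧ q.1 = c j := by
    intro j
    obtain ⟨q, hq⟩ := hsurj (β j)
    exact ⟨q, hq, by rw [← hg q.1 q.2]; exact hc _ _ hq⟩
  refine ⟨fun j => ?_, fun i j hij => ?_⟩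
  · obtain ⟨q, -, hq⟩ := key j
    exact hq ▸ q.2
  · obtain ⟨p, hp, hp'⟩ := key i
    obtain ⟨q, hq, hq'⟩ := key j
    rw [← hp, ← hq, Subtype.ext (hp'.trans (hij.trans hq'.symm))]

variable {n : ℕ} {lam : Multiset ℕ}

theorem special_outer_iff (henv : envelope lam = n) (v w : Fin n ⊕ Fin n) :
    (special n lam).outer v w ↔ block lam (node v) = block lam (node w) :=
  ⟨fun h => h.elim (fun h => h ▸ rfl) And.left, fun h => Or.inr ⟨h, not_isTail henv _⟩⟩

theorem special_inner_iff (v w : Fin n ⊕ Fin n) :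
    (special n lam).inner v w ↔ v = w ∨ (node v = node w ∧ comps lam (node v) ≠ 0) :=
  Iff.rfl

/-- The diagram `d` has at least the outer connections of the lower half of the special element,
and the lower nodes of the components `0` are inner singletons. -/
structure IsSpecialBelow (lam : Multiset ℕ) (d : Diagram n) : Prop where
  outer : ∀ i j, block lam i = block lam j → d.outer (Sum.inr i) (Sum.inr j)
  inner : ∀ j, comps lam j = 0 → ∀ v, d.inner (Sum.inr j) v → v = Sum.inr j

/-- Stacking above the special element keeps the connections of its bottom row, and a bottom
singleton has no edge upwards through which it could acquire new ones. -/
theorem isSpecialBelow_mul_special (henv : envelope lam = n) (D : Diagram n) :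
    IsSpecialBelow lam (D.mul (special n lam)) where
  outer i j h := comp_inr_inr ((special_outer_iff henv _ _).2 h)
  inner j h v hv := by
    obtain ⟨z, rfl, hz⟩ := comp_inr_of_forall_not (fun y hy => by
      rcases hy with hy | ⟨hy, hy'⟩
      · cases hy
      · change y = j at hy
        exact hy' (hy ▸ h)) hv
    exact hz.elim Eq.symm fun h' => absurd h h'.2

variable {d : Diagram n}

theorem IsSpecialBelow.comps_ne_zero (hd : IsSpecialBelow lam d) {p : PropPart d.inner} {j : Fin n}
    (hj : Quotient.mk d.inner (Sum.inr j) = p.1) : comps lam j ≠ 0 := by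
  obtain ⟨i, hi⟩ := p.2.1
  intro h0
  cases hd.inner j h0 (Sum.inl i) (Quotient.exact (hj.trans hi.symm))

/-- Each block lies in one outer part of `d`, so the components of `lam` are distributed over the
outer parts; those landing in a propagating part `q` bound its number of legs. -/
theorem IsSpecialBelow.indexLE (henv : envelope lam = n) (hd : IsSpecialBelow lam d) :
    IndexLE (propIndex d) lam := by
  classical
  let := Fintype.ofFinite (PropPart d.outer)
  -- A block goes to the propagating outer part containing its lower nodes, and to `none` if the
  -- outer part containing them does not propagate.
  let f : Fin (dominant lam).length → Option (PropPart d.outer) := fun i =>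
    if h : ∃ q : PropPart d.outer, ∃ j : Fin n, block lam j = i ∧
      Quotient.mk d.outer (Sum.inr j) = q.1 then some h.choose else none
  have hf : ∀ (j : Fin n) (q : PropPart d.outer), Quotient.mk d.outer (Sum.inr j) = q.1 →
      f ⟨block lam j, block_lt_length henv j⟩ = some q := by
    intro j q hq
    have h : ∃ q : PropPart d.outer, ∃ j' : Fin n, block lam j' = block lam j ∧
      Quotient.mk d.outer (Sum.inr j') = q.1 := ⟨q, j, rfl, hq⟩
    obtain ⟨j', hj', hq'⟩ := h.choose_spec
    simp only [f, dif_pos h]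
    refine congrArg some (Subtype.ext ?_)
    rw [← hq, ← hq']
    exact Quotient.sound (hd.outer _ _ hj')
  have := indexLE_of_fibers (fun i => (dominant lam)[i]) (fun q => legs d q.1) f ?_ ?_
  · rw [map_get_dominant] at this
    exact this
  · intro q
    obtain ⟨j, hj⟩ := q.2.2
    exact ⟨_, hf j q hj⟩
  · intro q
    have h : ∀ p : {p : PropPart d.inner // Setoid.map_of_le d.inner_le_outer p.1 = q.1},
        ∃ j : Fin n, Quotient.mk d.inner (Sum.inr j) = p.1.1 := fun p => p.1.2.2
    choose g hg using h
    -- One lower node for each inner propagating part inside `q`; such a node cannot be one of the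
    -- inner singletons, so its component is non-zero.
    have h1 : legs d q.1 ≤ Nat.card {j : Fin n // comps lam j ≠ 0 ∧
        Quotient.mk d.outer (Sum.inr j) = q.1} := by
      refine Nat.card_le_card_of_injective (fun p => ⟨g p, hd.comps_ne_zero (hg p), ?_⟩) ?_
      · rw [← p.2, ← hg p]
        rfl
      · intro p p' hpp
        have hpp' : g p = g p' := congrArg Subtype.val hpp
        refine Subtype.ext (Subtype.ext ?_)
        rw [← hg p, ← hg p', hpp']
    refine h1.trans ?_
    rw [Nat.card_eq_fintype_card, Fintype.card_subtype, Finset.card_eq_sum_card_fiberwise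
      (f := fun j => (⟨block lam j, block_lt_length henv j⟩ : Fin (dominant lam).length))
      (t := Finset.univ.filter fun i => f i = some q)]
    · refine Finset.sum_le_sum fun i _ => ?_
      refine le_trans (Finset.card_le_card ?_) (card_block_ne_zero henv i.2).le
      intro j hj
      simp only [Finset.mem_filter, Finset.mem_univ, true_and, Fin.ext_iff] at hj ⊢
      exact ⟨hj.2, hj.1.1⟩
    · intro j hj
      simp only [Finset.coe_filter, Finset.mem_univ, true_and, Set.mem_ofPred_eq] at hj ⊢
      exact hf j q hj.2

/-! ### Diagrams of full index are permuted special elements -/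

/-- The node of the special element below a vertex of the diagram `σ I`. -/
def nodeVia (σ : Equiv.Perm (Fin n)) (v : Fin n ⊕ Fin n) : Fin n := node (Sum.map σ.symm id v)

theorem perm_mul_special_outer_iff (henv : envelope lam = n) (σ : Equiv.Perm (Fin n))
    (v w : Fin n ⊕ Fin n) : ((Diagram.perm σ).mul (special n lam)).outer v w ↔
      block lam (nodeVia σ v) = block lam (nodeVia σ w) := by
  change comp (permPart σ) (special n lam).outer v w ↔ _
  rw [permPart_comp_eq, Setoid.comap_rel, special_outer_iff henv]
  rfl

theorem perm_mul_special_inner_iff (σ : Equiv.Perm (Fin n))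
    (v w : Fin n ⊕ Fin n) : ((Diagram.perm σ).mul (special n lam)).inner v w ↔
      v = w ∨ (nodeVia σ v = nodeVia σ w ∧ comps lam (nodeVia σ v) ≠ 0) := by
  have hinj : Function.Injective (Sum.map σ.symm id : Fin n ⊕ Fin n → Fin n ⊕ Fin n) :=
    Function.Injective.sumMap σ.symm.injective Function.injective_id
  change comp (permPart σ) (special n lam).inner v w ↔ _
  rw [permPart_comp_eq, Setoid.comap_rel, special_inner_iff, hinj.eq_iff]
  rfl

/-- Equality of indices equates the numbers of propagating parts with the numbers of blocks and of
nodes of non-zero component. All of these must then propagate separately, and matching lower nodes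
with upper ends yields the permutation. -/
theorem IsSpecialBelow.exists_perm (henv : envelope lam = n) (hd : IsSpecialBelow lam d)
    (hidx : propIndex d = lam) :
    ∃ σ : Equiv.Perm (Fin n), d = (Diagram.perm σ).mul (special n lam) := by
  obtain ⟨ho, ho'⟩ := forall_of_card_le
    (fun j : Fin n => (⟨block lam j, block_lt_length henv j⟩ : Fin (dominant lam).length))
    (fun j => Quotient.mk d.outer (Sum.inr j))
    (fun q => (∃ i, Quotient.mk d.outer (Sum.inl i) = q) ∧
      ∃ j, Quotient.mk d.outer (Sum.inr j) = q)
    (fun i j h => Quotient.sound (hd.outer i j (Fin.mk.inj h))) (fun q hq => hq.2)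
    (by rw [← card_propIndex, hidx, Nat.card_fin, length_dominant])
  obtain ⟨hi, hi'⟩ := forall_of_card_le
    (fun j : {j : Fin n // comps lam j ≠ 0} => j)
    (fun j => Quotient.mk d.inner (Sum.inr j.1))
    (fun q => (∃ i, Quotient.mk d.inner (Sum.inl i) = q) ∧
      ∃ j, Quotient.mk d.inner (Sum.inr j) = q)
    (fun i j h => by rw [h])
    (fun q hq => hq.2.elim fun j hj => ⟨⟨j, hd.comps_ne_zero (p := ⟨q, hq⟩) hj⟩, hj⟩)
    (by
      classical
      rw [← sum_propIndex, hidx, Nat.card_eq_fintype_card, Fintype.card_subtype,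
        card_comps_ne_zero henv])
  have hob : ∀ i j, d.outer (Sum.inr i) (Sum.inr j) → block lam i = block lam j := fun i j h =>
    Fin.mk.inj (ho' i j (Quotient.sound h))
  have hib : ∀ i j, comps lam i ≠ 0 → comps lam j ≠ 0 → d.inner (Sum.inr i) (Sum.inr j) → i = j :=
    fun i j h0 h0' h => congrArg Subtype.val (hi' ⟨i, h0⟩ ⟨j, h0'⟩ (Quotient.sound h))
  -- An upper end for each lower node: through its inner part when the component is non-zero,
  -- otherwise merely through its outer part.
  have ht : ∀ j, ∃ t, d.outer (Sum.inl t) (Sum.inr j) ∧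
      (comps lam j ≠ 0 → d.inner (Sum.inl t) (Sum.inr j)) := by
    intro j
    by_cases h : comps lam j = 0
    · obtain ⟨t, ht⟩ := (ho j).1
      exact ⟨t, Quotient.exact ht, fun h' => absurd h h'⟩
    · obtain ⟨t, ht⟩ := (hi ⟨j, h⟩).1
      exact ⟨t, d.inner_le_outer (Quotient.exact ht), fun _ => Quotient.exact ht⟩
  choose t ht ht' using ht
  have htinj : Function.Injective t := by
    intro i j hij
    have hb : block lam i = block lam j :=
      hob i j (d.outer.trans' (d.outer.symm' (ht i)) (hij ▸ ht j))
    by_cases h : comps lam i = 0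
    · exact eq_of_block_eq henv hb h
    · have h' : comps lam j ≠ 0 := comps_congr hb ▸ h
      exact hib i j h h' (d.inner.trans' (d.inner.symm' (ht' i h)) (hij ▸ ht' j h'))
  -- Full envelope enters here: every node belongs to a block and so has an upper end, and the
  -- injection `t` leaves no upper node over.
  let σ : Equiv.Perm (Fin n) := Equiv.ofBijective t (Finite.injective_iff_bijective.1 htinj)
  have hσ : ∀ x, t (σ.symm x) = x := fun x => σ.apply_symm_apply x
  have hout : ∀ v, d.outer v (Sum.inr (nodeVia σ v)) := by
    rintro (x | x)
    · have := ht (σ.symm x)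
      rwa [hσ] at this
    · exact d.outer.refl' _
  have hin : ∀ v, comps lam (nodeVia σ v) ≠ 0 → d.inner v (Sum.inr (nodeVia σ v)) := by
    rintro (x | x) h
    · have := ht' (σ.symm x) h
      rwa [hσ] at this
    · exact d.inner.refl' _
  have hbl : ∀ v w, d.outer v w ↔ block lam (nodeVia σ v) = block lam (nodeVia σ w) := by
    intro v w
    constructor
    · intro h
      exact hob _ _ (d.outer.trans' (d.outer.symm' (hout v)) (d.outer.trans' h (hout w)))
    · intro h
      exact d.outer.trans' (hout v) (d.outer.trans' (hd.outer _ _ h) (d.outer.symm' (hout w)))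
  refine ⟨σ, Diagram.ext (Setoid.ext fun v w => ?_) (Setoid.ext fun v w => ?_)⟩
  · rw [perm_mul_special_inner_iff]
    constructor
    · intro h
      have hb := (hbl v w).1 (d.inner_le_outer h)
      by_cases h0 : comps lam (nodeVia σ v) = 0
      · left
        -- For a component 0 the outer part already determines the node. If the two vertices lie in
        -- different rows, the lower one is an inner singleton, which contradicts `h`.
        have hvw := eq_of_block_eq henv hb h0
        rcases v with v | v <;> rcases w with w | w
        · exact congrArg Sum.inl (σ.symm.injective hvw)
        · exact hd.inner w ((show nodeVia σ (Sum.inl v) = w from hvw) ▸ h0) _ (d.inner.symm' h)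
        · exact (hd.inner v h0 _ h).symm
        · exact congrArg Sum.inr hvw
      · right
        have h0' : comps lam (nodeVia σ w) ≠ 0 := comps_congr hb ▸ h0
        exact ⟨hib _ _ h0 h0' (d.inner.trans' (d.inner.symm' (hin v h0))
          (d.inner.trans' h (hin w h0'))), h0⟩
    · rintro (rfl | ⟨h, h0⟩)
      · exact d.inner.refl' _
      · exact d.inner.trans' (hin v h0) (h ▸ d.inner.symm' (hin w (h ▸ h0)))
  · rw [perm_mul_special_outer_iff henv, hbl]

end

section

variable {n : ℕ} {lam : Multiset ℕ}

/-! ### Products of special elements and permutations -/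

theorem special_mul_special (henv : envelope lam = n) :
    (special n lam).mul (special n lam) = special n lam := by
  classical
  refine Diagram.ext (le_antisymm ?_ ?_) (le_antisymm ?_ ?_)
  · let φ : (Fin n ⊕ Fin n) ⊕ Fin n → Fin n ⊕ ((Fin n ⊕ Fin n) ⊕ Fin n) := fun v =>
      if comps lam (Sum.elim node id v) ≠ 0 then Sum.inl (Sum.elim node id v) else Sum.inr v
    have hφ : stack (special n lam).inner (special n lam).inner ≤ Setoid.ker φ := by
      rw [stack_le_ker_iff]
      constructor
      all_goals
        rintro v w (rfl | ⟨h, h'⟩)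
        · rfl
        · rw [Setoid.ker_def]
          rcases v with v | v <;> rcases w with w | w <;>
            (simp only [node, Sum.elim_inl, Sum.elim_inr, id] at h h'; subst h
             simp [φ, node, h'])
    intro v w h
    have h1 : φ (Sum.inl v) = φ (Sum.inl w) := hφ h
    simp only [φ, Sum.elim_inl] at h1
    by_cases h2 : comps lam (node v) = 0 <;> by_cases h3 : comps lam (node w) = 0 <;>
      simp only [h2, h3, ne_eq, not_true_eq_false, not_false_eq_true, if_true, if_false,
        reduceCtorEq, Sum.inr.injEq, Sum.inl.injEq] at h1
    · exact Or.inl h1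
    · exact Or.inr ⟨h1, h2⟩
  · rintro v w (rfl | ⟨h, h'⟩)
    · exact Setoid.refl' _ _
    · rcases v with v | v <;> rcases w with w | w <;>
        (simp only [node, Sum.elim_inl, Sum.elim_inr, id] at h h'; subst h)
      · exact Setoid.refl' _ _
      · exact comp_inl_inr (Or.inr ⟨rfl, h'⟩) (Or.inr ⟨rfl, h'⟩)
      · exact Setoid.symm' _ (comp_inl_inr (Or.inr ⟨rfl, h'⟩) (Or.inr ⟨rfl, h'⟩))
      · exact Setoid.refl' _ _
  · have hφ : stack (special n lam).outer (special n lam).outer ≤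
        Setoid.ker fun v => block lam (Sum.elim node id v) := by
      rw [stack_le_ker_iff]
      constructor
      all_goals
        intro v w h
        rw [special_outer_iff henv] at h
        rw [Setoid.ker_def]
        rcases v with v | v <;> rcases w with w | w <;> exact h
    intro v w h
    exact (special_outer_iff henv v w).2 (hφ h)
  · have key : ∀ v w : Fin n, block lam v = block lam w →
        comp (special n lam).outer (special n lam).outer (Sum.inl v) (Sum.inr w) := fun v w h =>
      comp_inl_inr (y := v) ((special_outer_iff henv _ _).2 rfl) ((special_outer_iff henv _ _).2 h)
    intro v w h
    have hb := (special_outer_iff henv v w).1 h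
    rcases v with v | v <;> rcases w with w | w
    · exact comp_inl_inl h
    · exact key v w hb
    · exact Setoid.symm' _ (key w v hb.symm)
    · exact comp_inr_inr h

/-- Every middle vertex is joined in the outer partition to the vertex above it. Hence no power of
the outer parameter appears in the square of the special element. -/
theorem loops_special_outer (henv : envelope lam = n) :
    loops (special n lam).outer (special n lam).outer = 0 := by
  have : IsEmpty {q : Quotient (stack (special n lam).outer (special n lam).outer) //
      ∀ v, Quotient.mk _ v = q → v ∈ Set.range Sum.inr} := by
    refine ⟨fun ⟨q, hq⟩ => ?_⟩
    induction q using Quotient.inductionOn with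
    | h v =>
      obtain ⟨y, rfl⟩ := hq v rfl
      have h : (special n lam).outer (Sum.inl y) (Sum.inr y) := (special_outer_iff henv _ _).2 rfl
      obtain ⟨z, hz⟩ := hq (Sum.inl (Sum.inl y))
        (Quotient.sound (stack_left (b := (special n lam).outer) h))
      cases hz
  exact Nat.card_of_isEmpty

/-- The permutation is read off from the inner pairs at non-zero components, and from the outer
parts at the components 0, whose blocks are single nodes. -/
theorem perm_mul_special_injective (henv : envelope lam = n) {σ τ : Equiv.Perm (Fin n)}
    (h : (Diagram.perm σ).mul (special n lam) = (Diagram.perm τ).mul (special n lam)) :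
    σ = τ := by
  have h1 : ∀ j, nodeVia σ (Sum.inl (σ j)) = j := fun j => σ.symm_apply_apply j
  have key : ∀ j, nodeVia τ (Sum.inl (σ j)) = j := by
    intro j
    by_cases h0 : comps lam j = 0
    · have : ((Diagram.perm σ).mul (special n lam)).outer (Sum.inr j) (Sum.inl (σ j)) :=
        (perm_mul_special_outer_iff henv _ _ _).2 (by rw [h1]; rfl)
      rw [h, perm_mul_special_outer_iff henv] at this
      exact (eq_of_block_eq henv this h0).symm
    · have : ((Diagram.perm σ).mul (special n lam)).inner (Sum.inl (σ j)) (Sum.inr j) :=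
        (perm_mul_special_inner_iff _ _ _).2 (Or.inr ⟨h1 j, by rwa [h1]⟩)
      rw [h, perm_mul_special_inner_iff] at this
      rcases this with h | h
      · cases h
      · exact h.1
  exact Equiv.ext fun j => (τ.symm_apply_eq.1 (key j))

/-- By rigidity the product is `τ I`. Comparing connections gives `τ = σ`, so the left factor `I` is
absorbed by `σ I`; this makes `σ` respect the blocks and their components. -/
theorem mem_symGroup_of_propIndex_eq (henv : envelope lam = n) {σ : Equiv.Perm (Fin n)}
    (hidx : propIndex ((special n lam).mul ((Diagram.perm σ).mul (special n lam))) = lam) :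
    σ ∈ symGroup n lam := by
  classical
  obtain ⟨τ, hτ⟩ : ∃ τ : Equiv.Perm (Fin n), (special n lam).mul ((Diagram.perm σ).mul
      (special n lam)) = (Diagram.perm τ).mul (special n lam) := by
    rw [← Diagram.mul_assoc'] at hidx ⊢
    exact (isSpecialBelow_mul_special henv _).exists_perm henv hidx
  have h1 : ∀ j, nodeVia σ (Sum.inl (σ j)) = j := fun j => σ.symm_apply_apply j
  have hb : ∀ j, block lam (τ.symm (σ j)) = block lam j := by
    intro j
    refine (perm_mul_special_outer_iff henv τ (Sum.inl (σ j)) (Sum.inr j)).1 ?_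
    rw [← hτ]
    exact comp_inl_inr (y := σ j) ((special_outer_iff henv _ _).2 rfl)
      ((perm_mul_special_outer_iff henv _ _ _).2 (by rw [h1]; rfl))
  -- If `j` had a non-zero component, the top vertex `σ j` would have to propagate in `τ I`; but at
  -- a component 0 it is an inner singleton of the left factor.
  have hz : ∀ j, comps lam (σ j) = 0 → comps lam j = 0 := by
    intro j h0
    by_contra hj
    have hin : ((Diagram.perm τ).mul (special n lam)).inner (Sum.inl (σ j))
        (Sum.inr (τ.symm (σ j))) :=
      (perm_mul_special_inner_iff _ _ _).2 (Or.inr ⟨rfl, by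
        change comps lam (τ.symm (σ j)) ≠ 0
        rwa [comps_congr (hb j)]⟩)
    rw [← hτ] at hin
    obtain ⟨y, hy | hy⟩ := exists_left_of_comp hin
    · cases hy
    · exact hy.2 h0
  have hτσ : τ = σ := by
    refine Equiv.ext fun j => ?_
    refine (τ.symm_apply_eq.1 ?_).symm
    by_cases h0 : comps lam j = 0
    · exact (eq_of_block_eq henv (hb j).symm h0).symm
    · have hin : ((special n lam).mul ((Diagram.perm σ).mul (special n lam))).inner
          (Sum.inl (σ j)) (Sum.inr j) :=
        comp_inl_inr (y := σ j) (Or.inr ⟨rfl, fun h => h0 (hz j h)⟩)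
          ((perm_mul_special_inner_iff _ _ _).2 (Or.inr ⟨h1 j, by rwa [h1]⟩))
      rw [hτ, perm_mul_special_inner_iff] at hin
      rcases hin with h | h
      · cases h
      · exact h.1
  subst hτσ
  have hbl : ∀ i j, block lam i = block lam j → block lam (τ.symm i) = block lam (τ.symm j) := by
    intro i j h
    refine (perm_mul_special_outer_iff henv τ (Sum.inl i) (Sum.inl j)).1 ?_
    rw [← hτ]
    exact comp_inl_inl ((special_outer_iff henv _ _).2 h)
  -- The inverse permutation induces a surjection on the finite set of blocks, which is therefore
  -- injective.
  have hbl' := (forall_of_card_le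
    (fun j : Fin n => (⟨block lam j, block_lt_length henv j⟩ : Fin (dominant lam).length))
    (fun j => (⟨block lam (τ.symm j), block_lt_length henv _⟩ : Fin (dominant lam).length))
    (fun _ => True) (fun i j h => Fin.ext (hbl i j (Fin.mk.inj h)))
    (fun q _ => by
      obtain ⟨j, hj⟩ := exists_block_eq henv q.2
      exact ⟨τ j, Fin.ext (by simpa using hj)⟩)
    (Nat.card_congr (Equiv.subtypeUnivEquiv fun _ => trivial).symm).le).2
  have hiff : ∀ i j, block lam (τ i) = block lam (τ j) ↔ block lam i = block lam j := by
    intro i j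
    constructor
    · intro h
      simpa using hbl _ _ h
    · intro h
      exact Fin.mk.inj (hbl' (τ i) (τ j) (Fin.ext (by simpa using h)))
  -- Block sizes cannot tell a component 0 from a component 1, as both have width 1. The components
  -- 0 are treated first: their nodes form a finite set that `τ.symm` maps into itself, so `τ`
  -- preserves it too.
  have hmaps : Set.MapsTo τ.symm {j | comps lam j = 0} {j | comps lam j = 0} := by
    intro j (hj : comps lam j = 0)
    exact hz (τ.symm j) (by simpa using hj)
  have hmaps' := Equiv.Perm.perm_symm_mapsTo_of_mapsTo τ.symm hmaps
  refine ⟨hiff, fun i => ?_, fun i hi => absurd hi (not_isTail henv i)⟩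
  by_cases h0 : comps lam i = 0
  · exact (hmaps' h0 : comps lam (τ i) = 0).trans h0.symm
  · have hw : width (comps lam (τ i)) = width (comps lam i) := by
      rw [comps_eq_getElem henv, comps_eq_getElem henv, ← card_block henv, ← card_block henv]
      refine (Eq.trans ?_ (Finset.card_map τ.toEmbedding)).trans rfl
      congr 1
      ext x
      simp only [Finset.mem_map, Finset.mem_filter, Finset.mem_univ, true_and,
        Equiv.coe_toEmbedding]
      constructor
      · intro h
        exact ⟨τ.symm x, (hiff _ _).1 (by simpa using h), by simp⟩
      · rintro ⟨y, h, rfl⟩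
        exact (hiff _ _).2 h
    rwa [width, width, if_neg h0, if_neg fun h => h0 (hz i h)] at hw

theorem card_add_sum_le_propCount_special (henv : envelope lam = n) :
    lam.card + lam.sum ≤ propCount (special n lam) := by
  classical
  refine add_le_add ?_ ?_
  · rw [← length_dominant, ← Nat.card_fin (dominant lam).length]
    choose g hg using fun i : Fin (dominant lam).length => exists_block_eq henv i.2
    refine Nat.card_le_card_of_injective (fun i => (⟨Quotient.mk _ (Sum.inr (g i)),
      ⟨g i, Quotient.sound ((special_outer_iff henv _ _).2 rfl)⟩, g i, rfl⟩ :
        PropPart (special n lam).outer)) ?_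
    intro i j hij
    have := Quotient.exact (congrArg Subtype.val hij)
    exact Fin.ext (by rw [← hg i, ← hg j]; exact (special_outer_iff henv _ _).1 this)
  · rw [← card_comps_ne_zero henv, ← Fintype.card_subtype, ← Nat.card_eq_fintype_card]
    refine Nat.card_le_card_of_injective (fun j => (⟨Quotient.mk _ (Sum.inr j.1),
      ⟨j.1, Quotient.sound (Or.inr ⟨rfl, j.2⟩)⟩, j.1, rfl⟩ :
        PropPart (special n lam).inner)) ?_
    intro i j hij
    rcases Quotient.exact (congrArg Subtype.val hij) with h | h
    · exact Subtype.ext (Sum.inr_injective h)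
    · exact Subtype.ext h.1

/-- The permutation can be undone, and products never gain propagating parts. -/
theorem card_add_sum_le_propCount_perm_mul_special (henv : envelope lam = n)
    (σ : Equiv.Perm (Fin n)) :
    lam.card + lam.sum ≤ propCount ((Diagram.perm σ).mul (special n lam)) := by
  have h : special n lam =
      (Diagram.perm σ⁻¹).mul ((Diagram.perm σ).mul (special n lam)) := by
    rw [← Diagram.mul_assoc', Diagram.perm_mul_perm, inv_mul_cancel, Diagram.perm_one_mul]
  refine (card_add_sum_le_propCount_special henv).trans ?_
  conv_lhs => rw [h]
  exact propCount_mul_le_right _ _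

end

section

open Alg

variable {k : Type*} [Field k] {Q₁ Q₂ : k} {n : ℕ} {lam : Multiset ℕ}

/-! ### The lower ideal -/

theorem Alg.induction_linear {motive : Alg Q₁ Q₂ n → Prop} (x : Alg Q₁ Q₂ n) (zero : motive 0)
    (add : ∀ x y, motive x → motive y → motive (x + y))
    (smul : ∀ (c : k) (a : Diagram n), motive (c • basis Q₁ Q₂ a)) : motive x := by
  refine Finsupp.induction_linear (motive := motive) x zero (fun f g => add f g) fun a c => ?_
  have h : (Finsupp.single a c : Diagram n →₀ k) = c • Finsupp.single a 1 :=
    (Finsupp.smul_single_one a c).symm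
  rw [h]
  exact smul c a

variable (Q₁ Q₂) in
/-- The span of the diagrams with less than `N` propagating parts, inner and outer. -/
noncomputable def propCountLT (n N : ℕ) : Submodule k (Alg Q₁ Q₂ n) :=
  Submodule.span k {x | ∃ d, propCount d < N ∧ x = basis Q₁ Q₂ d}

theorem basis_mem_propCountLT {N : ℕ} {d : Diagram n} (h : propCount d < N) :
    basis Q₁ Q₂ d ∈ propCountLT Q₁ Q₂ n N :=
  Submodule.subset_span ⟨d, h, rfl⟩

theorem mul_mem_propCountLT {N : ℕ} {x : Alg Q₁ Q₂ n} (hx : x ∈ propCountLT Q₁ Q₂ n N)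
    (y : Alg Q₁ Q₂ n) : y * x ∈ propCountLT Q₁ Q₂ n N := by
  induction hx using Submodule.span_induction with
  | mem x hx =>
    obtain ⟨d, hd, rfl⟩ := hx
    induction y using Alg.induction_linear with
    | zero => rw [zero_mul]; exact zero_mem _
    | add y z hy hz => rw [add_mul]; exact add_mem hy hz
    | smul c a =>
      rw [smul_mul_assoc, basis_mul_basis]
      exact Submodule.smul_mem _ _ (Submodule.smul_mem _ _
        (basis_mem_propCountLT ((propCount_mul_le_right _ _).trans_lt hd)))
  | zero => rw [mul_zero]; exact zero_mem _
  | add x z _ _ hx hz => rw [mul_add]; exact add_mem hx hz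
  | smul c x _ hx => rw [mul_smul_comm]; exact Submodule.smul_mem _ _ hx

theorem basis_mul_mem_propCountLT {N : ℕ} {d : Diagram n} (hd : propCount d < N)
    (y : Alg Q₁ Q₂ n) : basis Q₁ Q₂ d * y ∈ propCountLT Q₁ Q₂ n N := by
  induction y using Alg.induction_linear with
  | zero => rw [mul_zero]; exact zero_mem _
  | add y z hy hz => rw [mul_add]; exact add_mem hy hz
  | smul c a =>
    rw [mul_smul_comm, basis_mul_basis]
    exact Submodule.smul_mem _ _ (Submodule.smul_mem _ _
      (basis_mem_propCountLT ((propCount_mul_le_left _ _).trans_lt hd)))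

/-- Replaces the order on indices by a single number, a bound stable under multiplication on both
sides; any diagram reaching that number then has coefficient 0 on the lower ideal. -/
theorem lowerIdeal_le_propCountLT :
    (lowerIdeal Q₁ Q₂ n lam).restrictScalars k ≤
      propCountLT Q₁ Q₂ n (lam.card + lam.sum) := by
  intro x hx
  rw [Submodule.restrictScalars_mem] at hx
  induction hx using Submodule.span_induction with
  | mem x hx =>
    obtain ⟨a, y, ha, rfl⟩ := hx
    refine basis_mul_mem_propCountLT ?_ y
    rw [← card_add_sum_propIndex]
    exact ha.card_add_sum_lt
  | zero => exact zero_mem _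
  | add x z _ _ hx hz => exact add_mem hx hz
  | smul c x _ hx => exact mul_mem_propCountLT hx c

theorem basis_mem_lowerIdeal {a : Diagram n} (h : IndexLT (propIndex a) lam) :
    basis Q₁ Q₂ a ∈ lowerIdeal Q₁ Q₂ n lam :=
  Submodule.subset_span ⟨a, 1, h, (mul_one _).symm⟩

/-! ### The column of the special element -/

variable (Q₁ Q₂ n lam) in
/-- The map from `P` onto `P[lam]'` given by right multiplication by the special element. -/
noncomputable def toColumn : Alg Q₁ Q₂ n →ₗ[Alg Q₁ Q₂ n] sectionColumn Q₁ Q₂ n lam :=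
  ((lowerIdeal Q₁ Q₂ n lam).mkQ.comp (rightMul Q₁ Q₂ n (basis Q₁ Q₂ (special n lam)))).codRestrict
    (sectionColumn Q₁ Q₂ n lam) fun x =>
      Submodule.mem_map_of_mem (Submodule.smul_mem _ x (Submodule.mem_span_singleton_self _))

theorem coe_toColumn (x : Alg Q₁ Q₂ n) :
    (toColumn Q₁ Q₂ n lam x : Alg Q₁ Q₂ n ⧸ lowerIdeal Q₁ Q₂ n lam) =
      Submodule.Quotient.mk (x * basis Q₁ Q₂ (special n lam)) := rfl

theorem toColumn_surjective : Function.Surjective (toColumn Q₁ Q₂ n lam) := by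
  rintro ⟨_, x, hx, rfl⟩
  obtain ⟨y, rfl⟩ := Submodule.mem_span_singleton.1 hx
  exact ⟨y, rfl⟩

theorem toColumn_congr {x y : Alg Q₁ Q₂ n}
    (h : x * basis Q₁ Q₂ (special n lam) = y * basis Q₁ Q₂ (special n lam)) :
    toColumn Q₁ Q₂ n lam x = toColumn Q₁ Q₂ n lam y :=
  Subtype.ext (congrArg Submodule.Quotient.mk h)

theorem toColumn_eq_zero {x : Alg Q₁ Q₂ n} {c : k} {a : Diagram n}
    (h : x * basis Q₁ Q₂ (special n lam) = c • basis Q₁ Q₂ a) (ha : IndexLT (propIndex a) lam) :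
    toColumn Q₁ Q₂ n lam x = 0 := by
  refine Subtype.ext ((Submodule.Quotient.mk_eq_zero _).2 ?_)
  rw [rightMul_apply, h]
  exact Submodule.smul_of_tower_mem _ c (basis_mem_lowerIdeal ha)

theorem permHom_mul_basis (σ : Equiv.Perm (Fin n)) (a : Diagram n) :
    permHom Q₁ Q₂ n σ * basis Q₁ Q₂ a = basis Q₁ Q₂ ((Diagram.perm σ).mul a) :=
  (mulHom_basis _ _).trans (basisMul_perm_left _ _)

theorem basis_mul_permHom (σ : Equiv.Perm (Fin n)) (a : Diagram n) :
    basis Q₁ Q₂ a * permHom Q₁ Q₂ n σ = basis Q₁ Q₂ (a.mul (Diagram.perm σ)) :=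
  (mulHom_basis _ _).trans (basisMul_perm_right _ _)

/-- The column is spanned by the classes of the products of permutations and the special
element. -/
theorem toColumn_basis (henv : envelope lam = n) (a : Diagram n) :
    ∃ (c : k) (σ : Equiv.Perm (Fin n)),
      toColumn Q₁ Q₂ n lam (basis Q₁ Q₂ a) = c • toColumn Q₁ Q₂ n lam (permHom Q₁ Q₂ n σ) := by
  have hd := isSpecialBelow_mul_special henv a
  by_cases h : propIndex (a.mul (special n lam)) = lam
  · obtain ⟨σ, hσ⟩ := hd.exists_perm henv h
    refine ⟨Q₁ ^ loops a.inner (special n lam).inner * Q₂ ^ loops a.outer (special n lam).outer,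
      σ, ?_⟩
    rw [← LinearMap.map_smul_of_tower]
    refine toColumn_congr ?_
    rw [basis_mul_basis, hσ, smul_mul_assoc, permHom_mul_basis]
  · refine ⟨0, 1, ?_⟩
    rw [zero_smul]
    exact toColumn_eq_zero (basis_mul_basis _ _) ⟨hd.indexLE henv, h⟩

/-- The scalar counts the inner loops of `I I`, so a non-zero inner parameter suffices to make `I`
act on its own class by a non-zero scalar. -/
theorem toColumn_special (henv : envelope lam = n) (hQ : Q₁ ≠ 0) :
    ∃ c : k, c ≠ 0 ∧
      toColumn Q₁ Q₂ n lam (basis Q₁ Q₂ (special n lam)) = c • toColumn Q₁ Q₂ n lam 1 := by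
  refine ⟨_, pow_ne_zero (loops (special n lam).inner (special n lam).inner) hQ, ?_⟩
  rw [← LinearMap.map_smul_of_tower]
  refine toColumn_congr ?_
  rw [basis_mul_basis, special_mul_special henv, loops_special_outer henv, pow_zero, mul_one,
    smul_mul_assoc, one_mul]

/-- The index of `I σ I` is at most `lam`, and it equals `lam` only for `σ` in the group; otherwise
the product falls into the lower ideal. -/
theorem toColumn_special_mul_permHom (henv : envelope lam = n) {σ : Equiv.Perm (Fin n)}
    (hσ : σ ∉ symGroup n lam) :
    toColumn Q₁ Q₂ n lam (basis Q₁ Q₂ (special n lam) * permHom Q₁ Q₂ n σ) = 0 := by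
  refine toColumn_eq_zero (by rw [mul_assoc, permHom_mul_basis, basis_mul_basis]) ⟨?_, fun h =>
    hσ (mem_symGroup_of_propIndex_eq henv h)⟩
  rw [← Diagram.mul_assoc']
  exact (isSpecialBelow_mul_special henv _).indexLE henv

/-! ### The right action on the column -/

theorem op_smul_column (r : MonoidAlgebra k (symGroup n lam)) (m : sectionColumn Q₁ Q₂ n lam) :
    MulOpposite.op r • m =
      (MonoidAlgebra.lift k _ _ (rightPerm Q₁ Q₂ n lam) r).unop m := rfl

theorem op_smul_comm (r : MonoidAlgebra k (symGroup n lam)) (x : Alg Q₁ Q₂ n)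
    (m : sectionColumn Q₁ Q₂ n lam) :
    MulOpposite.op r • x • m = x • MulOpposite.op r • m := by
  rw [op_smul_column, op_smul_column, map_smul]

theorem op_smul_smul (c : k) (r : MonoidAlgebra k (symGroup n lam))
    (m : sectionColumn Q₁ Q₂ n lam) :
    MulOpposite.op (c • r) • m = c • MulOpposite.op r • m := by
  rw [op_smul_column, op_smul_column, map_smul]
  rfl

theorem op_of_smul_toColumn (s : symGroup n lam) (x : Alg Q₁ Q₂ n) :
    MulOpposite.op (MonoidAlgebra.of k _ s) • toColumn Q₁ Q₂ n lam x =
      toColumn Q₁ Q₂ n lam (x * permHom Q₁ Q₂ n s) := by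
  rw [op_smul_column, MonoidAlgebra.lift_of]
  refine Subtype.ext ?_
  change rightMulQ Q₁ Q₂ n lam (permHom Q₁ Q₂ n s) (Submodule.Quotient.mk _) = _
  rw [rightMulQ_mk, coe_toColumn, rightMul_apply, mul_assoc, mul_assoc, permHom_mul_special]

/-! ### Coefficient functionals on the column -/

variable (Q₁ Q₂) in
/-- The coefficient of `s I` on the column, for the special element `I`. -/
noncomputable def coeff (henv : envelope lam = n) (s : symGroup n lam) :
    sectionColumn Q₁ Q₂ n lam →ₗ[k] k :=
  (((lowerIdeal Q₁ Q₂ n lam).restrictScalars k).liftQ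
    (Finsupp.lapply ((Diagram.perm s.1).mul (special n lam)) : (Diagram n →₀ k) →ₗ[k] k) <| by
      -- The coefficient descends to the quotient because `s I` has too many propagating parts to be
      -- one of the diagrams spanning the bound for the lower ideal.
      refine lowerIdeal_le_propCountLT.trans (Submodule.span_le.2 ?_)
      rintro _ ⟨d, hd, rfl⟩
      refine Finsupp.single_eq_of_ne ?_
      rintro rfl
      exact hd.not_ge (card_add_sum_le_propCount_perm_mul_special henv _)).comp <|
  ((Submodule.Quotient.restrictScalarsEquiv k (lowerIdeal Q₁ Q₂ n lam)).symm.toLinearMap.comp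
    ((sectionColumn Q₁ Q₂ n lam).subtype.restrictScalars k))

theorem coeff_toColumn (henv : envelope lam = n) (s : symGroup n lam) (x : Alg Q₁ Q₂ n) :
    coeff Q₁ Q₂ henv s (toColumn Q₁ Q₂ n lam x) =
      (show Diagram n →₀ k from x * basis Q₁ Q₂ (special n lam))
        ((Diagram.perm s.1).mul (special n lam)) := rfl

theorem coeff_toColumn_one (henv : envelope lam = n) [DecidableEq (symGroup n lam)]
    (s : symGroup n lam) :
    coeff Q₁ Q₂ henv s (toColumn Q₁ Q₂ n lam 1) = if s = 1 then 1 else 0 := by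
  rw [coeff_toColumn, one_mul]
  split_ifs with h
  · rw [h]
    change Finsupp.single _ _ ((Diagram.perm 1).mul _) = _
    rw [Diagram.perm_one_mul, Finsupp.single_eq_same]
  · refine Finsupp.single_eq_of_ne fun h' => h (Subtype.ext ?_)
    refine perm_mul_special_injective henv (h'.trans ?_)
    exact (Diagram.perm_one_mul _).symm

/-- Right multiplication by a permutation permutes the diagrams without scalars, so it only moves
coefficients around. -/
theorem mul_permHom_apply (z : Alg Q₁ Q₂ n) (σ : Equiv.Perm (Fin n)) (d : Diagram n) :
    (show Diagram n →₀ k from z * permHom Q₁ Q₂ n σ) (d.mul (Diagram.perm σ)) =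
      (show Diagram n →₀ k from z) d := by
  classical
  induction z using Alg.induction_linear with
  | zero => rw [zero_mul]; rfl
  | add y z hy hz => rw [add_mul]; exact congrArg₂ (· + ·) hy hz
  | smul c a =>
    rw [smul_mul_assoc, basis_mul_permHom]
    refine congrArg (c * ·) ?_
    change Finsupp.single _ _ _ = Finsupp.single _ _ _
    rw [Finsupp.single_apply, Finsupp.single_apply]
    refine if_congr ⟨fun h => ?_, fun h => h ▸ rfl⟩ rfl rfl
    have := congrArg (fun d => Diagram.mul d (Diagram.perm σ⁻¹)) h
    simpa only [Diagram.mul_assoc', Diagram.perm_mul_perm, mul_inv_cancel,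
      Diagram.mul_perm_one] using this

/-- Since `I` commutes with `t`, the term `s I` becomes `s I t = (s t) I`. This equivariance is what
makes `toSimple` balanced. -/
theorem coeff_mul_op_of_smul (henv : envelope lam = n) (s t : symGroup n lam)
    (m : sectionColumn Q₁ Q₂ n lam) :
    coeff Q₁ Q₂ henv (s * t) (MulOpposite.op (MonoidAlgebra.of k _ t) • m) =
      coeff Q₁ Q₂ henv s m := by
  obtain ⟨x, rfl⟩ := toColumn_surjective m
  rw [op_of_smul_toColumn, coeff_toColumn, coeff_toColumn, mul_assoc, permHom_mul_special,
    ← mul_assoc, ← mul_permHom_apply (x * _) t.1]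
  congr 1
  rw [Diagram.mul_assoc', ← perm_mul_special t.2, ← Diagram.mul_assoc', Diagram.perm_mul_perm]
  rfl

end

open Alg

variable {k : Type*} [Field k] {Q₁ Q₂ : k} {n : ℕ} {lam : Multiset ℕ}

/-! ### The standard module -/

variable {L : Type*} [AddCommGroup L] [Module k L] [Module (MonoidAlgebra k (symGroup n lam)) L]

/-- The class of a pure tensor in the standard module. -/
noncomputable def stdTmul (m : sectionColumn Q₁ Q₂ n lam) (l : L) :
    StandardModule Q₁ Q₂ n lam L :=
  Submodule.Quotient.mk (m ⊗ₜ[k] l)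

theorem stdTmul_add (m : sectionColumn Q₁ Q₂ n lam) (l l' : L) :
    stdTmul m (l + l') = stdTmul m l + stdTmul m l' :=
  congrArg Submodule.Quotient.mk (TensorProduct.tmul_add m l l')

theorem add_stdTmul (m m' : sectionColumn Q₁ Q₂ n lam) (l : L) :
    stdTmul (m + m') l = stdTmul m l + stdTmul m' l :=
  congrArg Submodule.Quotient.mk (TensorProduct.add_tmul m m' l)

theorem stdTmul_zero (m : sectionColumn Q₁ Q₂ n lam) : stdTmul m (0 : L) = 0 :=
  congrArg Submodule.Quotient.mk (TensorProduct.tmul_zero L m)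

theorem zero_stdTmul (l : L) : stdTmul (0 : sectionColumn Q₁ Q₂ n lam) l = 0 :=
  congrArg Submodule.Quotient.mk (TensorProduct.zero_tmul _ l)

theorem smul_stdTmul (x : Alg Q₁ Q₂ n) (m : sectionColumn Q₁ Q₂ n lam) (l : L) :
    x • stdTmul m l = stdTmul (x • m) l := rfl

theorem stdTmul_smul (c : k) (m : sectionColumn Q₁ Q₂ n lam) (l : L) :
    stdTmul (c • m) l = stdTmul m (c • l) :=
  congrArg Submodule.Quotient.mk (TensorProduct.smul_tmul c m l)

theorem op_smul_stdTmul (r : MonoidAlgebra k (symGroup n lam)) (m : sectionColumn Q₁ Q₂ n lam)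
    (l : L) : stdTmul (MulOpposite.op r • m) l = stdTmul m (r • l) :=
  (Submodule.Quotient.eq _).2 (Submodule.subset_span ⟨m, r, l, rfl⟩)

theorem stdTmul_induction {motive : StandardModule Q₁ Q₂ n lam L → Prop}
    (v : StandardModule Q₁ Q₂ n lam L) (tmul : ∀ m l, motive (stdTmul m l))
    (add : ∀ v w, motive v → motive w → motive (v + w)) : motive v := by
  obtain ⟨t, rfl⟩ := Submodule.Quotient.mk_surjective _ v
  induction t with
  | zero =>
    have := tmul 0 0
    rwa [stdTmul_zero] at this
  | tmul m l => exact tmul m l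
  | add t t' ht ht' => exact add _ _ ht ht'

/-- Every element of the standard module is a combination over the cosets of `S[lam]`. -/
theorem exists_coset_sum (henv : envelope lam = n)
    [Fintype (Equiv.Perm (Fin n) ⧸ symGroup n lam)] (v : StandardModule Q₁ Q₂ n lam L) :
    ∃ f : Equiv.Perm (Fin n) ⧸ symGroup n lam → L,
      v = ∑ c, stdTmul (toColumn Q₁ Q₂ n lam (permHom Q₁ Q₂ n c.out)) (f c) := by
  classical
  have hadd : ∀ v w : StandardModule Q₁ Q₂ n lam L,
      (∃ f : Equiv.Perm (Fin n) ⧸ symGroup n lam → L,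
        v = ∑ c, stdTmul (toColumn Q₁ Q₂ n lam (permHom Q₁ Q₂ n c.out)) (f c)) →
      (∃ f : Equiv.Perm (Fin n) ⧸ symGroup n lam → L,
        w = ∑ c, stdTmul (toColumn Q₁ Q₂ n lam (permHom Q₁ Q₂ n c.out)) (f c)) →
      ∃ f : Equiv.Perm (Fin n) ⧸ symGroup n lam → L,
        v + w = ∑ c, stdTmul (toColumn Q₁ Q₂ n lam (permHom Q₁ Q₂ n c.out)) (f c) := by
    rintro _ _ ⟨f, rfl⟩ ⟨g, rfl⟩
    refine ⟨f + g, ?_⟩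
    simp only [Pi.add_apply, stdTmul_add, Finset.sum_add_distrib]
  induction v using stdTmul_induction with
  | add v w hv hw => exact hadd v w hv hw
  | tmul m l =>
    obtain ⟨x, rfl⟩ := toColumn_surjective m
    induction x using Alg.induction_linear with
    | zero => exact ⟨0, by simp [zero_stdTmul, stdTmul_zero]⟩
    | add x y hx hy => rw [map_add, add_stdTmul]; exact hadd _ _ hx hy
    | smul c a =>
      obtain ⟨c', σ, hσ⟩ := toColumn_basis (Q₁ := Q₁) (Q₂ := Q₂) henv a
      -- Factor `σ` as its coset representative times `s⁻¹`; this last factor and the scalars `c`,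
      -- `c'` are moved across the tensor sign to `l`.
      obtain ⟨s, hs⟩ := QuotientGroup.mk_out_eq_mul (symGroup n lam) σ
      have hσ' : σ = (QuotientGroup.mk σ : Equiv.Perm (Fin n) ⧸ symGroup n lam).out *
          (s⁻¹ : symGroup n lam) := by rw [hs]; simp
      refine ⟨Pi.single (QuotientGroup.mk σ) (MonoidAlgebra.of k _ s⁻¹ • (c' • c • l)), ?_⟩
      rw [Finset.sum_eq_single (QuotientGroup.mk σ : Equiv.Perm (Fin n) ⧸ symGroup n lam)
        (fun d _ hd => by rw [Pi.single_eq_of_ne hd, stdTmul_zero])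
        (fun h => absurd (Finset.mem_univ _) h), Pi.single_eq_same, ← op_smul_stdTmul,
        op_of_smul_toColumn, ← map_mul, ← hσ', LinearMap.map_smul_of_tower, hσ, stdTmul_smul,
        stdTmul_smul]

/-! ### Non-vanishing of the standard module -/

/-- The functional on `P[lam]' ⊗ L` that sends `I ⊗ l` to `l`, for the special
element `I`; it is balanced over the group algebra of `S[lam]`. -/
noncomputable def toSimple (henv : envelope lam = n) [Fintype (symGroup n lam)]
    [IsScalarTower k (MonoidAlgebra k (symGroup n lam)) L] :
    sectionColumn Q₁ Q₂ n lam ⊗[k] L →ₗ[k] L :=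
  ∑ s : symGroup n lam, TensorProduct.lift
    ((LinearMap.lsmul k L).comp (coeff Q₁ Q₂ henv s) |>.compl₂
      ((Algebra.lsmul k k L (MonoidAlgebra.of k _ s) : L →ₗ[k] L)))

theorem toSimple_tmul (henv : envelope lam = n) [Fintype (symGroup n lam)]
    [IsScalarTower k (MonoidAlgebra k (symGroup n lam)) L] (m : sectionColumn Q₁ Q₂ n lam)
    (l : L) : toSimple henv (m ⊗ₜ l) =
      ∑ s, coeff Q₁ Q₂ henv s m • (MonoidAlgebra.of k (symGroup n lam) s • l) := by
  simp [toSimple, LinearMap.sum_apply]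

theorem toSimple_balanced (henv : envelope lam = n) [Fintype (symGroup n lam)]
    [IsScalarTower k (MonoidAlgebra k (symGroup n lam)) L]
    (r : MonoidAlgebra k (symGroup n lam)) (m : sectionColumn Q₁ Q₂ n lam) (l : L) :
    toSimple henv ((MulOpposite.op r • m) ⊗ₜ l) = toSimple henv (m ⊗ₜ (r • l)) := by
  induction r using MonoidAlgebra.induction_on with
  | of t =>
    -- Substituting `s t` for `s` on the left turns the shifted coefficient back into that of `s`,
    -- and the factor `t` acts on `l`.
    rw [toSimple_tmul, toSimple_tmul, ← Equiv.sum_comp (Equiv.mulRight t)]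
    refine Finset.sum_congr rfl fun s _ => ?_
    rw [Equiv.coe_mulRight, coeff_mul_op_of_smul, map_mul, mul_smul]
  | add f g hf hg =>
    rw [MulOpposite.op_add, add_smul, add_smul, TensorProduct.add_tmul, TensorProduct.tmul_add,
      map_add, map_add, hf, hg]
  | smul c f hf =>
    rw [op_smul_smul, smul_assoc, TensorProduct.tmul_smul, ← TensorProduct.smul_tmul',
      map_smul, map_smul, hf]

/-- The functional is only `k`-linear, whereas the relations span a module over the whole algebra.
Quantifying over `x` carries the induction through; the left and right actions commute, so `x` times
a relation is again a relation. -/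
theorem toSimple_balancedRel (henv : envelope lam = n) [Fintype (symGroup n lam)]
    [IsScalarTower k (MonoidAlgebra k (symGroup n lam)) L]
    {t : sectionColumn Q₁ Q₂ n lam ⊗[k] L}
    (ht : t ∈ balancedRel k (Alg Q₁ Q₂ n) (MonoidAlgebra k (symGroup n lam))
      (sectionColumn Q₁ Q₂ n lam) L) (x : Alg Q₁ Q₂ n) : toSimple henv (x • t) = 0 := by
  induction ht using Submodule.span_induction generalizing x with
  | mem t ht =>
    obtain ⟨m, r, l, rfl⟩ := ht
    rw [smul_sub, TensorProduct.smul_tmul', TensorProduct.smul_tmul', ← op_smul_comm, map_sub,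
      toSimple_balanced, sub_self]
  | zero => rw [smul_zero, map_zero]
  | add t t' _ _ ht ht' => rw [smul_add, map_add, ht, ht', add_zero]
  | smul y t _ ht => rw [smul_smul, ht]

theorem stdTmul_ne_zero (henv : envelope lam = n)
    [IsScalarTower k (MonoidAlgebra k (symGroup n lam)) L] {l : L} (hl : l ≠ 0) :
    stdTmul (toColumn Q₁ Q₂ n lam 1) l ≠ 0 := by
  classical
  have := Fintype.ofFinite (symGroup n lam)
  intro h
  have hmem : toColumn Q₁ Q₂ n lam 1 ⊗ₜ[k] l ∈ balancedRel k (Alg Q₁ Q₂ n)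
      (MonoidAlgebra k (symGroup n lam)) (sectionColumn Q₁ Q₂ n lam) L :=
    (Submodule.Quotient.mk_eq_zero _).1 h
  have h0 := toSimple_balancedRel henv hmem 1
  rw [one_smul, toSimple_tmul, Finset.sum_eq_single 1 (fun s _ hs => by
    rw [coeff_toColumn_one, if_neg hs, zero_smul]) (fun h => absurd (Finset.mem_univ _) h),
    coeff_toColumn_one, if_pos rfl, one_smul, map_one, one_smul] at h0
  exact hl h0

/-! ### Simplicity -/

/-- A submodule that contains a nonzero pure tensor with the special element is everything. -/
theorem eq_top_of_stdTmul_mem [IsSimpleModule (MonoidAlgebra k (symGroup n lam)) L]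
    (N : Submodule (Alg Q₁ Q₂ n) (StandardModule Q₁ Q₂ n lam L)) {l₀ : L} (hl₀ : l₀ ≠ 0)
    (h : stdTmul (toColumn Q₁ Q₂ n lam 1) l₀ ∈ N) : N = ⊤ := by
  have hcol : ∀ m : sectionColumn Q₁ Q₂ n lam, ∃ x : Alg Q₁ Q₂ n,
      m = x • toColumn Q₁ Q₂ n lam 1 := by
    intro m
    obtain ⟨x, rfl⟩ := toColumn_surjective m
    exact ⟨x, by rw [← map_smul, smul_eq_mul, mul_one]⟩
  refine eq_top_iff.2 fun v _ => ?_
  induction v using stdTmul_induction with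
  | add v w hv hw => exact add_mem (hv trivial) (hw trivial)
  | tmul m l =>
    -- Simplicity of `L` writes `l` as `r • l₀`; moving `r` to the column, which is generated by the
    -- class of the special element, exhibits the tensor as an algebra multiple of the given one.
    obtain ⟨r, rfl⟩ := IsSimpleModule.toSpanSingleton_surjective
      (MonoidAlgebra k (symGroup n lam)) hl₀ l
    rw [LinearMap.toSpanSingleton_apply, ← op_smul_stdTmul]
    obtain ⟨x, hx⟩ := hcol (MulOpposite.op r • m)
    rw [hx, ← smul_stdTmul]
    exact N.smul_mem x h

/-- Translating the coset `c₀` to the trivial one and multiplying by the special element annihilates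
the terms of all other cosets, and scales the surviving one by a unit. -/
theorem exists_stdTmul_mem (henv : envelope lam = n) (hQ : Q₁ ≠ 0)
    (N : Submodule (Alg Q₁ Q₂ n) (StandardModule Q₁ Q₂ n lam L)) (hN : N ≠ ⊥) :
    ∃ l : L, l ≠ 0 ∧ stdTmul (toColumn Q₁ Q₂ n lam 1) l ∈ N := by
  classical
  have := Fintype.ofFinite (Equiv.Perm (Fin n) ⧸ symGroup n lam)
  obtain ⟨v, hv, hv0⟩ := Submodule.exists_mem_ne_zero_of_ne_bot hN
  obtain ⟨f, rfl⟩ := exists_coset_sum henv v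
  obtain ⟨c₀, hc₀⟩ : ∃ c, f c ≠ 0 := by
    by_contra! h
    exact hv0 (Finset.sum_eq_zero fun c _ => by rw [h, stdTmul_zero])
  obtain ⟨q, hq, hcol⟩ := toColumn_special (Q₁ := Q₁) (Q₂ := Q₂) henv hQ
  refine ⟨q • f c₀, smul_ne_zero hq hc₀, ?_⟩
  have hmem := N.smul_mem (basis Q₁ Q₂ (special n lam) * permHom Q₁ Q₂ n c₀.out⁻¹) hv
  have hterm : ∀ c : Equiv.Perm (Fin n) ⧸ symGroup n lam,
      (basis Q₁ Q₂ (special n lam) * permHom Q₁ Q₂ n c₀.out⁻¹) •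
        stdTmul (toColumn Q₁ Q₂ n lam (permHom Q₁ Q₂ n c.out)) (f c) =
      stdTmul (toColumn Q₁ Q₂ n lam (basis Q₁ Q₂ (special n lam) *
        permHom Q₁ Q₂ n (c₀.out⁻¹ * c.out))) (f c) := by
    intro c
    rw [smul_stdTmul, ← map_smul, smul_eq_mul, mul_assoc, ← map_mul]
  rw [Finset.smul_sum, Finset.sum_congr rfl (fun c _ => hterm c), Finset.sum_eq_single c₀
    (fun c _ hc => ?_) (fun h => absurd (Finset.mem_univ _) h), inv_mul_cancel, map_one, mul_one,
    hcol, stdTmul_smul] at hmem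
  · exact hmem
  · rw [toColumn_special_mul_permHom henv, zero_stdTmul]
    -- A term survives only if `c₀.out⁻¹ * c.out` lies in the group, which means that both cosets
    -- agree.
    intro h
    refine hc ?_
    rw [← QuotientGroup.out_eq' c, ← QuotientGroup.out_eq' c₀]
    exact (QuotientGroup.eq.2 h).symm

end RamifiedPartition

open RamifiedPartition in
theorem mainTheorem7 {k : Type*} [Field k] (Qinner Qouter : k) (hQ : IsUnit Qinner)
    (n : ℕ) (lam : Multiset ℕ) (henv : envelope lam = n)
    (L : Type*) [AddCommGroup L] [Module k L] [Module (MonoidAlgebra k (symGroup n lam)) L]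
    [IsScalarTower k (MonoidAlgebra k (symGroup n lam)) L]
    [IsSimpleModule (MonoidAlgebra k (symGroup n lam)) L] :
    IsSimpleModule (Alg Qinner Qouter n) (StandardModule Qinner Qouter n lam L) := by
  have := IsSimpleModule.nontrivial (MonoidAlgebra k (symGroup n lam)) L
  obtain ⟨l, hl⟩ := exists_ne (0 : L)
  have : Nontrivial (StandardModule Qinner Qouter n lam L) :=
    ⟨⟨_, 0, stdTmul_ne_zero henv hl⟩⟩
  have : IsSimpleOrder (Submodule (Alg Qinner Qouter n) (StandardModule Qinner Qouter n lam L)) :=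
    { eq_bot_or_eq_top := fun N => or_iff_not_imp_left.2 fun hN => by
        obtain ⟨l₀, hl₀, h⟩ := exists_stdTmul_mem henv hQ.ne_zero N hN
        exact eq_top_of_stdTmul_mem N hl₀ h }
  exact isSimpleModule_iff _ _ |>.2 this
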